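/- Let $\rho\in\mathbb{R}$, $\sigma,c\in(0,\infty)$, and let $\eta_1$ be a probability measure on $\mathbb{R}$. Let $M(z,\mathrm{d}x)=\mathcal{N}(\rho z,\sigma^2)$, $G(x)=e^{-cx^2/2}$ and $Q(z,\mathrm{d}x)=M(z,\mathrm{d}x)\,G(x)$. Consider the state-space model $Y_t=X_t+c^{-1/2}Z_t$, $X_{t+1}=\rho X_t+\sigma W_{t+1}$, $t\ge 1$, with $X_1\sim\eta_1$ and independent $\mathcal{N}(0,1)$ noises, observed at $y_t=0$ for all $t\ge 1$. Its filtering distributions $(\hat\eta_t)_{t\ge 1}$ and predictive distributions $(\eta_t)_{t\ge 1}$ are given by $$\hat\eta_1(\mathrm{d}x)=\frac{G(x)\,\eta_1(\mathrm{d}x)}{\eta_1(G)},\qquad \hat\eta_t=\frac{\hat\eta_1Q^{t-1}}{\hat\eta_1Q^{t-1}(\mathbb{R})},\qquad \eta_t=\hat\eta_{t-1}M,\qquad t\ge 2 .$$ For a probability measure $\pi$ on $\mathbb{R}$ let $F_\pi$ be its distribution function, let $F_\pi^{-1}(u)=\inf\{x: F_\pi(x)\ge u\}$, and let $\|\pi_1-\pi_2\|=\sup_{a\in\mathbb{R}}|F_{\pi_1}(a)-F_{\pi_2}(a)|$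 be the Kolmogorov distance. For $N\ge 1$, let $U_t^n=(U_{t,1}^n,U_{t,2}^n)$, $t\ge 1$, $1\le n\le N$, be independent random variables uniformly distributed on $(0,1)^2$. The bootstrap particle filter with multinomial resampling is defined by $X_1^n=F_{\eta_1}^{-1}(U_{1,1}^n)$ and, for $t\ge 2$, $$\hat X_{t-1}^n=F^{-1}_{\hat\eta_{t-1}^N}(U_{t,1}^n),\qquad X_t^n=F^{-1}_{M(\hat X_{t-1}^n,\cdot)}(U_{t,2}^n),$$ where, for all $t\ge 1$, $$\eta_t^N=\frac1N\sum_{n=1}^N\delta_{X_t^n},\qquad \hat\eta_t^N=\sum_{n=1}^N\frac{G(X_t^n)}{\sum_{m=1}^NG(X_t^m)}\,\delta_{X_t^n}.$$ Theorem. There exists a constant $\bar C_1\in(0,\infty)$, depending only on $\rho$, $\sigma$, $c$ and $\eta_1$, such that for all $N\ge 1$, all $q\in(0,1)$ and all integers $T\ge 1$, with probability at least $1-q$, $$\max\Big\{\sup_{1\le t\le T}\|\hat\eta_t^N-\hat\eta_t\|,\ \sup_{1\le t\le T}\|\eta_t^N-\eta_t\|\Big\}\le \bar C_1\,\delta^{1/2}\log\big(1+\delta^{-1/2}\big),\qquad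 \delta=\frac{1+\log(T/q)}{N}.$$ -/

import Mathlib

open MeasureTheory ProbabilityTheory

namespace ToyPF

noncomputable section

/-- The Kolmogorov distance `sup_a |F_μ(a) - F_ν(a)|` between two probability measures on `ℝ`. -/
def kolmogorovDist (μ ν : Measure ℝ) : ℝ :=
  ⨆ a : ℝ, |cdf μ a - cdf ν a|

/-- The generalized inverse `F_μ⁻¹(u) = inf {x | u ≤ F_μ(x)}` of the distribution function of a
probability measure on `ℝ` (meaningful for `u` in the open unit interval). -/
def quantile (μ : Measure ℝ) (u : ℝ) : ℝ :=
  sInf {x : ℝ | u ≤ cdf μ x}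

/-- A finite nonzero measure divided by its total mass. -/
def normalizeMeasure (m : Measure ℝ) : Measure ℝ :=
  (m Set.univ)⁻¹ • m

/-- The Markov kernel `M(z, dx) = N(ρ z, σ²)`. -/
def transition (ρ σ : ℝ) : Kernel ℝ ℝ where
  toFun z := gaussianReal (ρ * z) (σ ^ 2).toNNReal
  measurable' := measurable_gaussianReal.comp
    ((measurable_const.mul measurable_id).prodMk measurable_const)

instance (ρ σ : ℝ) : IsMarkovKernel (transition ρ σ) :=
  ⟨fun z => inferInstanceAs
    (IsProbabilityMeasure (gaussianReal (ρ * z) (σ ^ 2).toNNReal))⟩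

/-- The likelihood `G(x) = exp(-c x² / 2)` of the observation `0`, up to a constant factor. -/
def potential (c x : ℝ) : ℝ :=
  Real.exp (-(c * x ^ 2) / 2)

/-- The unnormalized kernel `Q(z, dx) = M(z, dx) G(x)`. -/
def unnormalizedKernel (ρ σ c : ℝ) : Kernel ℝ ℝ :=
  (transition ρ σ).withDensity fun _ x => ENNReal.ofReal (potential c x)

/-- The filtering distribution at time 1, i.e. `G(x) η₁(dx) / η₁(G)`. -/
def filteringInit (c : ℝ) (η₁ : Measure ℝ) : Measure ℝ :=
  normalizeMeasure (η₁.withDensity fun x => ENNReal.ofReal (potential c x))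

/-- The filtering distributions, all observations being `0`. The index `k` stands for the time
`t = k + 1`: the distribution at time `t` is the normalization of `filteringInit` times
`Q ^ (t - 1)`. -/
def filteringDist (ρ σ c : ℝ) (η₁ : Measure ℝ) (k : ℕ) : Measure ℝ :=
  normalizeMeasure ((filteringInit c η₁).bind ⇑(unnormalizedKernel ρ σ c ^ k))

/-- The predictive distributions, all observations being `0`. The index `k` stands for the time
`t = k + 1`: at time 1 this is `η₁`, and at time `t ≥ 2` it is the filtering distribution at time
`t - 1` times `M`. -/
def predictiveDist (ρ σ c : ℝ) (η₁ : Measure ℝ) : ℕ → Measure ℝ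
  | 0 => η₁
  | k + 1 => (filteringDist ρ σ c η₁ k).bind ⇑(transition ρ σ)

/-- The normalized importance weights of the particles `x 0, …, x (N - 1)`. -/
def weight {N : ℕ} (c : ℝ) (x : Fin N → ℝ) (n : Fin N) : ℝ :=
  potential c (x n) / ∑ m, potential c (x m)

/-- The uniformly weighted empirical measure of `N` particles. -/
def empirical {N : ℕ} (x : Fin N → ℝ) : Measure ℝ :=
  (N : ENNReal)⁻¹ • ∑ n, Measure.dirac (x n)

/-- The empirical measure of `N` particles with their normalized importance weights. -/
def weightedEmpirical {N : ℕ} (c : ℝ) (x : Fin N → ℝ) : Measure ℝ :=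
  ∑ n, ENNReal.ofReal (weight c x n) • Measure.dirac (x n)

/-- The particles of the bootstrap filter with multinomial resampling, driven by the points
`u k n` of the unit square. The index `k` stands for the time `t = k + 1`. The first coordinate
generates the initial particle (at time 1) or the resampled one (at later times), the second
coordinate the mutation. -/
def particles {N : ℕ} (ρ σ c : ℝ) (η₁ : Measure ℝ) (u : ℕ → Fin N → ℝ × ℝ) :
    ℕ → Fin N → ℝ
  | 0 => fun n => quantile η₁ (u 0 n).1
  | k + 1 => fun n =>
      quantile
        (transition ρ σ
          (quantile (weightedEmpirical c (particles ρ σ c η₁ u k)) (u (k + 1) n).1))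
        (u (k + 1) n).2

/-- The particle estimate of the predictive distribution at time `k + 1`. -/
def predictiveEstimate {N : ℕ} (ρ σ c : ℝ) (η₁ : Measure ℝ) (u : ℕ → Fin N → ℝ × ℝ) (k : ℕ) :
    Measure ℝ :=
  empirical (particles ρ σ c η₁ u k)

/-- The particle estimate of the filtering distribution at time `k + 1`. -/
def filteringEstimate {N : ℕ} (ρ σ c : ℝ) (η₁ : Measure ℝ) (u : ℕ → Fin N → ℝ × ℝ) (k : ℕ) :
    Measure ℝ :=
  weightedEmpirical c (particles ρ σ c η₁ u k)

/-- The uniform distribution on `(0,1)²`. -/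
def uniformSquare : Measure (ℝ × ℝ) :=
  volume.restrict (Set.Ioo 0 1 ×ˢ Set.Ioo 0 1)

/-- `δ = (1 + log (T / q)) / N`. -/
def delta (N T : ℕ) (q : ℝ) : ℝ :=
  (1 + Real.log (T / q)) / N

end

end ToyPF

/-!
The theorem rests on two facts: one time step of the particle filter makes a local error of order
`N ^ (-1/2)`, up to logarithms, and the exact filter forgets errors exponentially fast.

**Forgetting.** Write `e_a` for `potential a`, the function `exp (-a x² / 2)`, and let
`Φ = predictiveStep` be the exact map from one predictive distribution to the next. Completing the
square shows that, `k + 1` steps ahead, the distribution function of `Φ^[k + 1] μ` at `x` is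
`μ (e_a ψ) / μ (e_a)`, where `a` stays between `c` and `A = c + ρ² / σ²` and `ψ` comes from the
Gaussian distribution function by repeated Gaussian smoothing and rescaling. Each backward step
replaces `a` by `a' = c + ρ² a / (1 + a σ²)` and multiplies the Lipschitz constant of `ψ` by
`r = |ρ| / (1 + a σ²)`. Since `r² ≤ (a' - c) / a ≤ (1 - c / A) a' / a`, the product of the factors
`r²` telescopes and decays geometrically, even for `|ρ| > 1` (`exists_smooth_representation`). Only
the oscillation of `ψ` matters in the ratio, and the total variation of `e_a (ψ - ψ 0)` is at most a
constant times the Lipschitz constant of `ψ`, so integration by parts bounds the Kolmogorov distance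
of `Φ^[k + 1] μ` and `Φ^[k + 1] ν` by a geometrically small multiple of that of `μ` and `ν`, provided
that `μ (e_A)` and `ν (e_A)` are bounded below (`kolmogorovLE_iterate_predictiveStep`).

**Tightness.** The exact predictive distributions converge to a Gaussian fixed point of `Φ`, so they
charge `e_A` uniformly in time (`exists_le_integral_potential_iterate`). As long as the accumulated
error is small, the particle approximations inherit this; the accumulated error is a geometric sum of
local errors, which closes an induction over time (`exists_error_propagation`).

**Local errors.** Given the past, the new particles are independent with law `Φ` of the current
empirical measure, because the composition of two quantile functions samples from the filter and
then from the transition (`map_quantile_quantile`). Hoeffding's inequality at the `N` quantiles of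
that law bounds the probability of a local error above `ε + 1 / N` by `4 N exp (-2 N ε²)`
(`dvoretzky_kiefer_wolfowitz`). The factor `N` is paid for by the factor `log (1 + δ ^ (-1/2))` of
the rate (`four_mul_exp_le`), and a union bound over the times up to `T` concludes.
-/

namespace ToyPF

noncomputable section

/-! ### Reweighting by Gaussian likelihoods, and Kolmogorov distance -/

lemma potential_pos (a x : ℝ) : 0 < potential a x := Real.exp_pos _

lemma potential_le_one {a : ℝ} (ha : 0 ≤ a) (x : ℝ) : potential a x ≤ 1 := by
  unfold potential
  rw [Real.exp_le_one_iff]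
  have := mul_nonneg ha (sq_nonneg x)
  linarith

lemma potential_anti {a b : ℝ} (hab : a ≤ b) (x : ℝ) : potential b x ≤ potential a x := by
  unfold potential
  gcongr

@[fun_prop]
lemma continuous_potential (a : ℝ) : Continuous (potential a) := by
  unfold potential
  fun_prop

@[fun_prop]
lemma measurable_potential (a : ℝ) : Measurable (potential a) :=
  (continuous_potential a).measurable

lemma hasDerivAt_potential (a x : ℝ) :
    HasDerivAt (potential a) (-(a * x) * potential a x) x := by
  have h : HasDerivAt (fun x : ℝ => -(a * x ^ 2) / 2) (-(a * x)) x := by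
    have := (((hasDerivAt_id x).pow 2).const_mul a).neg.div_const 2
    refine this.congr_deriv ?_
    simp
    ring
  have := h.exp
  unfold potential
  convert this using 1
  ring

lemma integrable_of_measurable_of_abs_le {μ : Measure ℝ} [IsFiniteMeasure μ] {f : ℝ → ℝ} {b : ℝ}
    (hf : Measurable f) (hb : ∀ x, |f x| ≤ b) : Integrable f μ :=
  Integrable.of_bound hf.aestronglyMeasurable b (Filter.Eventually.of_forall hb)

lemma integrable_potential {a : ℝ} (ha : 0 ≤ a) (μ : Measure ℝ) [IsFiniteMeasure μ] :
    Integrable (potential a) μ :=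
  integrable_of_measurable_of_abs_le (b := 1) (by fun_prop) fun x => by
    rw [abs_of_pos (potential_pos a x)]
    exact potential_le_one ha x

lemma integral_potential_pos {a : ℝ} (ha : 0 ≤ a) (μ : Measure ℝ) [IsProbabilityMeasure μ] :
    0 < ∫ x, potential a x ∂μ := by
  rw [integral_pos_iff_support_of_nonneg (fun x => (potential_pos a x).le)
    (integrable_potential ha μ)]
  have : Function.support (fun x => potential a x) = Set.univ := by
    ext x
    simp [(potential_pos a x).ne']
  rw [this]
  simp

/-- Bayes' rule for the observation `0`: the measure `μ` reweighted by the likelihood. -/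
abbrev bayesUpdate (c : ℝ) (μ : Measure ℝ) : Measure ℝ := filteringInit c μ

/-- The map taking a predictive distribution to the next one: Bayes update, then one move of the
signal. -/
def predictiveStep (ρ σ c : ℝ) (μ : Measure ℝ) : Measure ℝ :=
  (bayesUpdate c μ).bind (transition ρ σ)

lemma withDensity_potential_univ {c : ℝ} (hc : 0 ≤ c) (μ : Measure ℝ) [IsProbabilityMeasure μ] :
    (μ.withDensity fun x => ENNReal.ofReal (potential c x)) Set.univ =
      ENNReal.ofReal (∫ x, potential c x ∂μ) := by
  rw [withDensity_apply _ MeasurableSet.univ, Measure.restrict_univ,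
    ofReal_integral_eq_lintegral_ofReal (integrable_potential hc μ)
      (Filter.Eventually.of_forall fun x => (potential_pos c x).le)]

lemma isProbabilityMeasure_normalizeMeasure {m : Measure ℝ} (h0 : m Set.univ ≠ 0)
    (ht : m Set.univ ≠ ⊤) : IsProbabilityMeasure (normalizeMeasure m) :=
  ⟨by simp [normalizeMeasure, ENNReal.inv_mul_cancel h0 ht]⟩

lemma normalizeMeasure_smul {m : Measure ℝ} {a : ENNReal} (h0 : a ≠ 0) (ht : a ≠ ⊤) :
    normalizeMeasure (a • m) = normalizeMeasure m := by
  unfold normalizeMeasure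
  rw [smul_smul, Measure.smul_apply, smul_eq_mul, ENNReal.mul_inv (Or.inl h0) (Or.inl ht),
    mul_right_comm, ENNReal.inv_mul_cancel h0 ht, one_mul]

lemma isProbabilityMeasure_bayesUpdate {c : ℝ} (hc : 0 ≤ c) (μ : Measure ℝ)
    [IsProbabilityMeasure μ] : IsProbabilityMeasure (bayesUpdate c μ) := by
  refine isProbabilityMeasure_normalizeMeasure ?_ ?_
  · rw [withDensity_potential_univ hc]
    simpa using integral_potential_pos hc μ
  · rw [withDensity_potential_univ hc]
    simp

lemma isProbabilityMeasure_predictiveStep (ρ σ : ℝ) {c : ℝ} (hc : 0 ≤ c) (μ : Measure ℝ)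
    [IsProbabilityMeasure μ] : IsProbabilityMeasure (predictiveStep ρ σ c μ) := by
  have := isProbabilityMeasure_bayesUpdate hc μ
  unfold predictiveStep
  infer_instance

lemma integral_bayesUpdate {c : ℝ} (hc : 0 ≤ c) (μ : Measure ℝ) [IsProbabilityMeasure μ]
    (f : ℝ → ℝ) :
    ∫ x, f x ∂(bayesUpdate c μ) = (∫ x, potential c x * f x ∂μ) / ∫ x, potential c x ∂μ := by
  unfold bayesUpdate filteringInit normalizeMeasure
  rw [integral_smul_measure, withDensity_potential_univ hc,
    integral_withDensity_eq_integral_toReal_smul (by fun_prop) (by simp), ENNReal.toReal_inv,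
    ENNReal.toReal_ofReal (integral_potential_pos hc μ).le, smul_eq_mul, div_eq_inv_mul]
  congr 1
  refine integral_congr_ae (Filter.Eventually.of_forall fun x => ?_)
  simp [ENNReal.toReal_ofReal (potential_pos c x).le]

lemma cdf_bayesUpdate {c : ℝ} (hc : 0 ≤ c) (μ : Measure ℝ) [IsProbabilityMeasure μ] (x : ℝ) :
    cdf (bayesUpdate c μ) x =
      (∫ y in Set.Iic x, potential c y ∂μ) / ∫ y, potential c y ∂μ := by
  have := isProbabilityMeasure_bayesUpdate hc μ
  rw [cdf_eq_real, ← integral_indicator_one measurableSet_Iic, integral_bayesUpdate hc,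
    ← integral_indicator measurableSet_Iic]
  congr 2 with y
  by_cases hy : y ≤ x <;> simp [Set.indicator, hy]

lemma integral_predictiveStep (ρ σ : ℝ) {c : ℝ} (hc : 0 ≤ c) (μ : Measure ℝ)
    [IsProbabilityMeasure μ] {f : ℝ → ℝ} {b : ℝ} (hf : Measurable f) (hb : ∀ x, |f x| ≤ b) :
    ∫ x, f x ∂(predictiveStep ρ σ c μ) =
      (∫ z, potential c z * ∫ x, f x ∂(transition ρ σ z) ∂μ) / ∫ z, potential c z ∂μ := by
  have := isProbabilityMeasure_bayesUpdate hc μ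
  rw [← integral_bayesUpdate hc]
  unfold predictiveStep
  rw [Measure.comp_eq_comp_const_apply, Kernel.integral_comp]
  · simp
  · rw [← Measure.comp_eq_comp_const_apply]
    exact integrable_of_measurable_of_abs_le hf hb

lemma cdf_predictiveStep (ρ σ : ℝ) {c : ℝ} (hc : 0 ≤ c) (μ : Measure ℝ)
    [IsProbabilityMeasure μ] (x : ℝ) :
    cdf (predictiveStep ρ σ c μ) x =
      (∫ z, potential c z * cdf (transition ρ σ z) x ∂μ) / ∫ z, potential c z ∂μ := by
  have := isProbabilityMeasure_predictiveStep ρ σ hc μ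
  rw [cdf_eq_real, ← integral_indicator_one measurableSet_Iic,
    integral_predictiveStep ρ σ hc μ (b := 1)
      (measurable_one.indicator measurableSet_Iic)
      (fun y => by by_cases hy : y ≤ x <;> simp [Set.indicator, hy])]
  congr 2 with z
  rw [cdf_eq_real, ← integral_indicator_one measurableSet_Iic]

/-- `μ` and `ν` have Kolmogorov distance at most `d`. -/
def KolmogorovLE (μ ν : Measure ℝ) (d : ℝ) : Prop :=
  ∀ x, |cdf μ x - cdf ν x| ≤ d

lemma KolmogorovLE.symm {μ ν : Measure ℝ} {d : ℝ} (h : KolmogorovLE μ ν d) :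
    KolmogorovLE ν μ d := fun x => by
  rw [abs_sub_comm]
  exact h x

lemma KolmogorovLE.trans {μ ν π : Measure ℝ} {d e : ℝ} (h : KolmogorovLE μ ν d)
    (h' : KolmogorovLE ν π e) : KolmogorovLE μ π (d + e) := fun x =>
  (abs_sub_le _ (cdf ν x) _).trans (add_le_add (h x) (h' x))

lemma KolmogorovLE.mono {μ ν : Measure ℝ} {d e : ℝ} (h : KolmogorovLE μ ν d) (hde : d ≤ e) :
    KolmogorovLE μ ν e := fun x => (h x).trans hde

lemma kolmogorovLE_refl (μ : Measure ℝ) : KolmogorovLE μ μ 0 := fun x => by simp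

lemma kolmogorovLE_one (μ ν : Measure ℝ) : KolmogorovLE μ ν 1 := fun x => by
  rw [abs_le]
  have h1 := cdf_nonneg μ x
  have h2 := cdf_le_one μ x
  have h3 := cdf_nonneg ν x
  have h4 := cdf_le_one ν x
  constructor <;> linarith

lemma KolmogorovLE.nonneg {μ ν : Measure ℝ} {d : ℝ} (h : KolmogorovLE μ ν d) : 0 ≤ d :=
  (abs_nonneg _).trans (h 0)

lemma KolmogorovLE.kolmogorovDist_le {μ ν : Measure ℝ} {d : ℝ} (h : KolmogorovLE μ ν d) :
    kolmogorovDist μ ν ≤ d := ciSup_le h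

lemma integral_tail_eq (μ : Measure ℝ) [IsProbabilityMeasure μ] {k : ℝ → ℝ} (hk : Integrable k) :
    Integrable (fun t => ∫ y in Set.Ici t, k y) μ ∧
      ∫ t, (∫ y in Set.Ici t, k y) ∂μ = ∫ y, cdf μ y * k y := by
  have hint : Integrable (Function.uncurry fun t y : ℝ => (Set.Ici t).indicator k y)
      (μ.prod volume) := by
    have h1 : Integrable (fun p : ℝ × ℝ => k p.2) (μ.prod volume) := hk.comp_snd μ
    have h2 := h1.indicator (s := {p : ℝ × ℝ | p.1 ≤ p.2})
      (measurableSet_le measurable_fst measurable_snd)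
    refine h2.congr (Filter.Eventually.of_forall ?_)
    rintro ⟨t, y⟩
    simp [Function.uncurry, Set.indicator]
  have key : ∀ t, ∫ y in Set.Ici t, k y = ∫ y, (Set.Ici t).indicator k y := fun t =>
    (integral_indicator measurableSet_Ici).symm
  simp_rw [key]
  refine ⟨hint.integral_prod_left, ?_⟩
  rw [integral_integral_swap hint]
  congr 1 with y
  have : (fun t => (Set.Ici t).indicator k y) = (Set.Iic y).indicator fun _ => k y := by
    ext t
    simp [Set.indicator]
  rw [this, integral_indicator_const _ measurableSet_Iic, cdf_eq_real, smul_eq_mul]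

/-- Integration by parts: the integral of a function that jumps down by `α` at `x` and otherwise
has derivative `k` and limit `0` at infinity is controlled by the Kolmogorov distance times its
total variation. -/
lemma KolmogorovLE.abs_integral_sub_le {μ ν : Measure ℝ} [IsProbabilityMeasure μ]
    [IsProbabilityMeasure ν] {d : ℝ} (h : KolmogorovLE μ ν d) {f k : ℝ → ℝ} {α x : ℝ}
    (hk : Integrable k)
    (hf : ∀ t, f t = (Set.Iic x).indicator (fun _ => α) t - ∫ y in Set.Ici t, k y) :
    |∫ t, f t ∂μ - ∫ t, f t ∂ν| ≤ d * (|α| + ∫ y, |k y|) := by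
  have main : ∀ π : Measure ℝ, IsProbabilityMeasure π →
      ∫ t, f t ∂π = cdf π x * α - ∫ y, cdf π y * k y := by
    intro π _
    have := integral_tail_eq π hk
    simp_rw [hf]
    rw [integral_sub ((integrable_const α).indicator measurableSet_Iic) this.1, this.2,
      integral_indicator_const _ measurableSet_Iic, cdf_eq_real, smul_eq_mul]
  have hint : ∀ π : Measure ℝ, IsProbabilityMeasure π → Integrable fun y => cdf π y * k y := by
    intro π _
    refine hk.bdd_mul (c := 1) (monotone_cdf π).measurable.aestronglyMeasurable
      (Filter.Eventually.of_forall fun y => ?_)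
    rw [Real.norm_eq_abs, abs_of_nonneg (cdf_nonneg _ _)]
    exact cdf_le_one _ _
  rw [main μ inferInstance, main ν inferInstance]
  have e : cdf μ x * α - (∫ y, cdf μ y * k y) - (cdf ν x * α - ∫ y, cdf ν y * k y) =
      (cdf μ x - cdf ν x) * α - ∫ y, (cdf μ y - cdf ν y) * k y := by
    simp_rw [sub_mul]
    rw [integral_sub (hint μ inferInstance) (hint ν inferInstance)]
    ring
  rw [e, mul_add]
  refine (abs_sub _ _).trans (add_le_add ?_ ?_)
  · rw [abs_mul]
    exact mul_le_mul_of_nonneg_right (h x) (abs_nonneg _)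
  · rw [← integral_const_mul]
    refine (abs_integral_le_integral_abs).trans (integral_mono_of_nonneg
      (Filter.Eventually.of_forall fun y => abs_nonneg _) (hk.abs.const_mul d)
      (Filter.Eventually.of_forall fun y => ?_))
    simp only [abs_mul]
    exact mul_le_mul_of_nonneg_right (h y) (abs_nonneg _)

/-! ### Iterates of the exact predictive step -/

lemma gaussianPDFReal_mul_potential {a s : ℝ} (ha : 0 ≤ a) (hs : 0 < s) (m x : ℝ) :
    gaussianPDFReal m s.toNNReal x * potential a x =
      (√(1 + a * s))⁻¹ * potential (a / (1 + a * s)) m *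
        gaussianPDFReal (m / (1 + a * s)) (s / (1 + a * s)).toNNReal x := by
  have h1 : 0 < 1 + a * s := by positivity
  have h2 : 0 < s / (1 + a * s) := by positivity
  unfold gaussianPDFReal potential
  rw [Real.coe_toNNReal _ hs.le, Real.coe_toNNReal _ h2.le]
  have e1 : (√(2 * Real.pi * s))⁻¹ =
      (√(1 + a * s))⁻¹ * (√(2 * Real.pi * (s / (1 + a * s))))⁻¹ := by
    rw [← mul_inv, ← Real.sqrt_mul h1.le]
    congr 2
    field_simp
  rw [e1, mul_assoc, ← Real.exp_add, mul_mul_mul_comm, ← Real.exp_add]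
  congr 2
  field_simp
  ring

/-- A Gaussian reweighted by a centred Gaussian likelihood is Gaussian again. -/
lemma integral_potential_mul_gaussianReal {a s : ℝ} (ha : 0 ≤ a) (hs : 0 < s) (m : ℝ)
    (f : ℝ → ℝ) :
    ∫ x, potential a x * f x ∂(gaussianReal m s.toNNReal) =
      (√(1 + a * s))⁻¹ * potential (a / (1 + a * s)) m *
        ∫ x, f x ∂(gaussianReal (m / (1 + a * s)) (s / (1 + a * s)).toNNReal) := by
  have h1 : 0 < 1 + a * s := by positivity
  have h2 : 0 < s / (1 + a * s) := by positivity
  rw [integral_gaussianReal_eq_integral_smul (by simpa using hs),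
    integral_gaussianReal_eq_integral_smul (by simpa using h2), ← integral_const_mul]
  congr 1 with x
  simp only [smul_eq_mul]
  rw [← mul_assoc, gaussianPDFReal_mul_potential ha hs]
  ring

/-- Differentiable functions bounded by `1` whose derivative is bounded by `L`. -/
structure IsSmooth (ψ : ℝ → ℝ) (L : ℝ) : Prop where
  differentiable : Differentiable ℝ ψ
  abs_le_one : ∀ x, |ψ x| ≤ 1
  abs_deriv_le : ∀ x, |deriv ψ x| ≤ L

lemma integral_gaussianReal_eq_integral_add (f : ℝ → ℝ) (m : ℝ) (v : NNReal) :
    ∫ x, f x ∂(gaussianReal m v) = ∫ y, f (m + y) ∂(gaussianReal 0 v) := by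
  have h := gaussianReal_map_const_add (μ := 0) (v := v) m
  rw [zero_add] at h
  rw [← h]
  exact (MeasurableEquiv.addLeft m).measurableEmbedding.integral_map f

lemma IsSmooth.integral_gaussianReal {ψ : ℝ → ℝ} {L : ℝ} (h : IsSmooth ψ L) (r : ℝ)
    (v : NNReal) :
    IsSmooth (fun z => ∫ x, ψ x ∂(gaussianReal (r * z) v)) (|r| * L) := by
  have hder : ∀ z, HasDerivAt (fun z => ∫ y, ψ (r * z + y) ∂(gaussianReal 0 v))
      (∫ y, r * deriv ψ (r * z + y) ∂(gaussianReal 0 v)) z := by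
    intro z
    have hm : ∀ z, Measurable fun y => ψ (r * z + y) := fun z =>
      h.differentiable.continuous.measurable.comp (by fun_prop)
    refine (hasDerivAt_integral_of_dominated_loc_of_deriv_le (bound := fun _ => |r| * L)
      (F := fun z y => ψ (r * z + y))
      (F' := fun z y => r * deriv ψ (r * z + y)) Filter.univ_mem ?_ ?_ ?_ ?_ ?_ ?_).2
    · exact Filter.Eventually.of_forall fun z => (hm z).aestronglyMeasurable
    · exact integrable_of_measurable_of_abs_le (hm z) fun y => h.abs_le_one _
    · exact (((measurable_deriv ψ).comp (by fun_prop)).const_mul r).aestronglyMeasurable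
    · refine Filter.Eventually.of_forall fun y z _ => ?_
      rw [Real.norm_eq_abs, abs_mul]
      exact mul_le_mul_of_nonneg_left (h.abs_deriv_le _) (abs_nonneg _)
    · exact integrable_const _
    · refine Filter.Eventually.of_forall fun y z _ => ?_
      have h1 : HasDerivAt (fun z => r * z + y) r z := by
        simpa using ((hasDerivAt_id z).const_mul r).add_const y
      have := (h.differentiable (r * z + y)).hasDerivAt.comp z h1
      rwa [mul_comm] at this
  have e : (fun z => ∫ x, ψ x ∂(gaussianReal (r * z) v)) =
      fun z => ∫ y, ψ (r * z + y) ∂(gaussianReal 0 v) := by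
    ext z
    exact integral_gaussianReal_eq_integral_add _ _ _
  refine ⟨fun z => ?_, fun z => ?_, fun z => ?_⟩
  · rw [e]
    exact (hder z).differentiableAt
  · have := norm_integral_le_of_norm_le_const (μ := gaussianReal (r * z) v) (f := ψ) (C := 1)
      (Filter.Eventually.of_forall fun x => h.abs_le_one x)
    simpa using this
  · rw [e, (hder z).deriv]
    have := norm_integral_le_of_norm_le_const (μ := gaussianReal 0 v)
      (f := fun y => r * deriv ψ (r * z + y)) (C := |r| * L)
      (Filter.Eventually.of_forall fun y => by
        rw [Real.norm_eq_abs, abs_mul]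
        exact mul_le_mul_of_nonneg_left (h.abs_deriv_le _) (abs_nonneg _))
    simpa using this

lemma hasDerivAt_cdf_gaussianReal (m : ℝ) {v : NNReal} (hv : v ≠ 0) (x : ℝ) :
    HasDerivAt (cdf (gaussianReal m v)) (gaussianPDFReal m v x) x := by
  have hc : Continuous (gaussianPDFReal m v) := by
    unfold gaussianPDFReal
    fun_prop
  have hi := integrable_gaussianPDFReal m v
  have e : ⇑(cdf (gaussianReal m v)) = fun y =>
      (∫ t in Set.Iic x, gaussianPDFReal m v t) + ∫ t in x..y, gaussianPDFReal m v t := by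
    ext y
    rw [cdf_eq_real, Measure.real, gaussianReal_apply_eq_integral _ hv,
      ENNReal.toReal_ofReal (integral_nonneg fun t => gaussianPDFReal_nonneg _ _ _),
      ← intervalIntegral.integral_Iic_sub_Iic hi.integrableOn hi.integrableOn]
    ring
  rw [e]
  exact ((hc.integral_hasStrictDerivAt x x).hasDerivAt).const_add _

lemma gaussianPDFReal_le (m : ℝ) (v : NNReal) (x : ℝ) :
    gaussianPDFReal m v x ≤ (√(2 * Real.pi * v))⁻¹ := by
  unfold gaussianPDFReal
  refine mul_le_of_le_one_right (by positivity) ?_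
  rw [Real.exp_le_one_iff, neg_div]
  simp only [Left.neg_nonpos_iff]
  positivity

lemma isSmooth_cdf_transition (ρ : ℝ) {σ : ℝ} (hσ : 0 < σ) (x : ℝ) :
    IsSmooth (fun z => cdf (transition ρ σ z) x)
      (|ρ| * (√(2 * Real.pi * (σ ^ 2).toNNReal))⁻¹) := by
  have hv : (σ ^ 2).toNNReal ≠ 0 := by
    simp only [ne_eq, Real.toNNReal_eq_zero, not_le]
    positivity
  have e : (fun z => cdf (transition ρ σ z) x) =
      fun z => cdf (gaussianReal 0 (σ ^ 2).toNNReal) (x - ρ * z) := by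
    ext z
    have h := gaussianReal_map_const_add (μ := 0) (v := (σ ^ 2).toNNReal) (ρ * z)
    rw [zero_add] at h
    rw [cdf_eq_real, cdf_eq_real]
    change (gaussianReal (ρ * z) (σ ^ 2).toNNReal).real _ = _
    rw [← h, map_measureReal_apply (by fun_prop) measurableSet_Iic]
    congr 1
    ext y
    simp [le_sub_iff_add_le']
  have hder : ∀ z, HasDerivAt (fun z => cdf (gaussianReal 0 (σ ^ 2).toNNReal) (x - ρ * z))
      (gaussianPDFReal 0 (σ ^ 2).toNNReal (x - ρ * z) * -ρ) z := fun z => by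
    refine (hasDerivAt_cdf_gaussianReal 0 hv (x - ρ * z)).comp z ?_
    simpa using ((hasDerivAt_id z).const_mul ρ).const_sub x
  refine ⟨fun z => ?_, fun z => ?_, fun z => ?_⟩
  · rw [e]
    exact (hder z).differentiableAt
  · rw [abs_of_nonneg (cdf_nonneg _ _)]
    exact cdf_le_one _ _
  · rw [e, (hder z).deriv, abs_mul, abs_neg, abs_of_nonneg (gaussianPDFReal_nonneg _ _ _),
      mul_comm]
    exact mul_le_mul_of_nonneg_left (gaussianPDFReal_le _ _ _) (abs_nonneg _)

/-- One step back in time: the function `e_a ψ` at the next time is seen at the present time as a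
multiple of `e_a' ψ'`, with `ψ'` a Gaussian smoothing of `ψ` rescaled by `ρ / (1 + a σ²)`. -/
lemma potential_mul_integral_transition (ρ : ℝ) {σ c a : ℝ} (hσ : 0 < σ)
    (ha : 0 ≤ a) (ψ : ℝ → ℝ) (z : ℝ) :
    potential c z * ∫ x, potential a x * ψ x ∂(transition ρ σ z) =
      (√(1 + a * σ ^ 2))⁻¹ * (potential (c + ρ ^ 2 * a / (1 + a * σ ^ 2)) z *
        ∫ x, ψ x ∂(gaussianReal (ρ / (1 + a * σ ^ 2) * z)
          (σ ^ 2 / (1 + a * σ ^ 2)).toNNReal)) := by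
  have h1 : 0 < 1 + a * σ ^ 2 := by positivity
  change potential c z * ∫ x, potential a x * ψ x ∂(gaussianReal (ρ * z) (σ ^ 2).toNNReal) = _
  rw [integral_potential_mul_gaussianReal ha (by positivity)]
  have e1 : potential (c + ρ ^ 2 * a / (1 + a * σ ^ 2)) z =
      potential c z * potential (a / (1 + a * σ ^ 2)) (ρ * z) := by
    unfold potential
    rw [← Real.exp_add]
    congr 1
    field_simp
    ring
  rw [e1, mul_div_right_comm]
  ring

/-- An upper bound for the curvatures `a` met when the recursion
`a ↦ c + ρ² a / (1 + a σ²)` runs from `c`. -/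
def curvatureBound (ρ σ c : ℝ) : ℝ := c + ρ ^ 2 / σ ^ 2

/-- The rate at which the squared derivatives shrink. -/
def contractionRate (ρ σ c : ℝ) : ℝ := 1 - c / curvatureBound ρ σ c

section
variable {ρ σ c : ℝ}

lemma le_curvatureBound (ρ σ c : ℝ) : c ≤ curvatureBound ρ σ c := by
  unfold curvatureBound
  have : 0 ≤ ρ ^ 2 / σ ^ 2 := by positivity
  linarith

lemma contractionRate_nonneg (ρ σ : ℝ) (hc : 0 < c) : 0 ≤ contractionRate ρ σ c := by
  unfold contractionRate
  have h := le_curvatureBound ρ σ c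
  have : c / curvatureBound ρ σ c ≤ 1 := (div_le_one (hc.trans_le h)).2 h
  linarith

lemma contractionRate_lt_one (ρ σ : ℝ) (hc : 0 < c) : contractionRate ρ σ c < 1 := by
  unfold contractionRate
  have h := le_curvatureBound ρ σ c
  have : 0 < c / curvatureBound ρ σ c := div_pos hc (hc.trans_le h)
  linarith

lemma curvature_step_le (hσ : 0 < σ) {a : ℝ} (ha : 0 ≤ a) :
    c + ρ ^ 2 * a / (1 + a * σ ^ 2) ≤ curvatureBound ρ σ c := by
  unfold curvatureBound
  have h1 : 0 < 1 + a * σ ^ 2 := by positivity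
  have : ρ ^ 2 * a / (1 + a * σ ^ 2) ≤ ρ ^ 2 / σ ^ 2 := by
    rw [div_le_div_iff₀ h1 (by positivity)]
    nlinarith [sq_nonneg ρ]
  linarith

lemma sq_slope_step_le (hσ : 0 < σ) (hc : 0 < c) {a : ℝ} (ha : 0 < a) :
    (|ρ / (1 + a * σ ^ 2)|) ^ 2 * a ≤
      (c + ρ ^ 2 * a / (1 + a * σ ^ 2)) * contractionRate ρ σ c := by
  have h1 : 1 ≤ 1 + a * σ ^ 2 := by
    have : 0 ≤ a * σ ^ 2 := by positivity
    linarith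
  have hA := hc.trans_le (le_curvatureBound ρ σ c)
  set a' := c + ρ ^ 2 * a / (1 + a * σ ^ 2) with ha'
  have hle : a' ≤ curvatureBound ρ σ c := curvature_step_le hσ ha.le
  have e1 : (|ρ / (1 + a * σ ^ 2)|) ^ 2 * a ≤ a' - c := by
    rw [sq_abs, div_pow, ha', add_sub_cancel_left, div_mul_eq_mul_div]
    gcongr
    nlinarith
  have e2 : a' * contractionRate ρ σ c = a' - c * (a' / curvatureBound ρ σ c) := by
    unfold contractionRate
    field_simp
  have e3 : a' / curvatureBound ρ σ c ≤ 1 := (div_le_one hA).2 hle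
  rw [e2]
  nlinarith

/-- The iterates of the predictive step: `k + 1` steps ahead, the distribution function is the
mean of a function `ψ` of derivative `O(θ ^ (k / 2))` under the initial law reweighted by
`e_a`. Here `θ < 1` is the contraction rate. -/
lemma exists_smooth_representation (hσ : 0 < σ) (hc : 0 < c) (k : ℕ) :
    ∃ a L : ℝ, c ≤ a ∧ a ≤ curvatureBound ρ σ c ∧ 0 ≤ L ∧
      L ^ 2 ≤ (|ρ| * (√(2 * Real.pi * (σ ^ 2).toNNReal))⁻¹) ^ 2 * (a / c) *
        contractionRate ρ σ c ^ k ∧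
      ∀ x, ∃ ψ, IsSmooth ψ L ∧ ∀ μ : Measure ℝ, IsProbabilityMeasure μ →
        cdf ((predictiveStep ρ σ c)^[k + 1] μ) x =
          (∫ z, potential a z * ψ z ∂μ) / ∫ z, potential a z ∂μ := by
  induction k with
  | zero =>
    refine ⟨c, _, le_rfl, le_curvatureBound ρ σ c, by positivity, ?_, fun x =>
      ⟨_, isSmooth_cdf_transition ρ hσ x, fun μ _ => ?_⟩⟩
    · rw [div_self hc.ne', pow_zero, mul_one, mul_one]
    · exact cdf_predictiveStep ρ σ hc.le μ x
  | succ k ih =>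
    obtain ⟨a, L, hca, haA, hL, hL2, h⟩ := ih
    have ha : 0 < a := hc.trans_le hca
    have h1 : 0 < 1 + a * σ ^ 2 := by positivity
    refine ⟨c + ρ ^ 2 * a / (1 + a * σ ^ 2), |ρ / (1 + a * σ ^ 2)| * L,
      le_add_of_nonneg_right (by positivity), curvature_step_le hσ ha.le, by positivity, ?_,
      fun x => ?_⟩
    · rw [mul_pow]
      set B := |ρ| * (√(2 * Real.pi * (σ ^ 2).toNNReal))⁻¹
      have hθ := contractionRate_nonneg ρ σ hc
      calc |ρ / (1 + a * σ ^ 2)| ^ 2 * L ^ 2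
          ≤ |ρ / (1 + a * σ ^ 2)| ^ 2 * (B ^ 2 * (a / c) * contractionRate ρ σ c ^ k) := by
            gcongr
        _ = (|ρ / (1 + a * σ ^ 2)| ^ 2 * a) * (B ^ 2 / c * contractionRate ρ σ c ^ k) := by
            ring
        _ ≤ ((c + ρ ^ 2 * a / (1 + a * σ ^ 2)) * contractionRate ρ σ c) *
              (B ^ 2 / c * contractionRate ρ σ c ^ k) := by
            exact mul_le_mul_of_nonneg_right (sq_slope_step_le hσ hc ha) (by positivity)
        _ = _ := by ring
    · obtain ⟨ψ, hψ, hrep⟩ := h x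
      refine ⟨_, hψ.integral_gaussianReal (ρ / (1 + a * σ ^ 2))
        (σ ^ 2 / (1 + a * σ ^ 2)).toNNReal, fun μ _ => ?_⟩
      rw [Function.iterate_succ_apply,
        hrep _ (isProbabilityMeasure_predictiveStep ρ σ hc.le μ)]
      have hpos := integral_potential_pos hc.le μ
      have hw : 0 < (√(1 + a * σ ^ 2))⁻¹ := by positivity
      have e1 := potential_mul_integral_transition (c := c) ρ hσ ha.le ψ
      have e2 := potential_mul_integral_transition (c := c) ρ hσ ha.le fun _ => 1
      simp only [mul_one, integral_const, probReal_univ, smul_eq_mul] at e2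
      rw [integral_predictiveStep ρ σ hc.le μ (b := 1) (f := fun z => potential a z * ψ z)
          ((measurable_potential a).mul hψ.differentiable.continuous.measurable) (fun z => ?_),
        integral_predictiveStep ρ σ hc.le μ (b := 1) (measurable_potential a) (fun z => ?_)]
      · simp_rw [e1, e2]
        rw [integral_const_mul, integral_const_mul, div_div_div_cancel_right₀ hpos.ne',
          mul_div_mul_left _ _ hw.ne']
      · rw [abs_of_pos (potential_pos a z)]
        exact potential_le_one ha.le z
      · rw [abs_mul, abs_of_pos (potential_pos a z)]
        exact mul_le_one₀ (potential_le_one ha.le z) (abs_nonneg _) (hψ.abs_le_one z)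

end

/-! ### Exponential forgetting -/

section
variable {ρ σ c : ℝ}

/-- A bound, for every curvature `a` between `c` and the curvature bound, of the total variation
of `e_a φ` when `|φ z| ≤ 1 + |z|` and `|φ'| ≤ 1`. -/
def variationBound (ρ σ c : ℝ) : ℝ :=
  ∫ z, (1 + 2 * curvatureBound ρ σ c) * ((1 + z ^ 2) * potential c z)

lemma integrable_one_add_sq_mul_potential (hc : 0 < c) :
    Integrable fun z : ℝ => (1 + z ^ 2) * potential c z := by
  have h2 : 0 < c / 2 := by positivity
  have h := (integrable_exp_neg_mul_sq h2).add
    (integrable_rpow_mul_exp_neg_mul_sq h2 (s := 2) (by norm_num))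
  refine h.congr (Filter.Eventually.of_forall fun z => ?_)
  have : -(c / 2) * z ^ 2 = -(c * z ^ 2) / 2 := by ring
  simp only [Pi.add_apply, Real.rpow_two, this, potential]
  ring

lemma tendsto_potential_atTop {a : ℝ} (ha : 0 < a) :
    Filter.Tendsto (potential a) Filter.atTop (nhds 0) := by
  unfold potential
  refine Real.tendsto_exp_atBot.comp ?_
  have h : Filter.Tendsto (fun x : ℝ => x ^ 2) Filter.atTop Filter.atTop :=
    Filter.tendsto_pow_atTop (by norm_num)
  have := h.const_mul_atTop_of_neg (r := -(a / 2)) (by linarith)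
  refine this.congr fun x => ?_
  ring

lemma variationBound_nonneg (hc : 0 < c) : 0 ≤ variationBound ρ σ c := by
  have := hc.trans_le (le_curvatureBound ρ σ c)
  refine integral_nonneg fun z => ?_
  have := (potential_pos c z).le
  positivity

/-- Integrals of `e_a φ` are Lipschitz for the Kolmogorov distance, and bounded. -/
lemma abs_integral_potential_mul_le (hc : 0 < c) {a L : ℝ} (hca : c ≤ a)
    (haA : a ≤ curvatureBound ρ σ c) {φ : ℝ → ℝ} (hφ : Differentiable ℝ φ)
    (hb : ∀ z, |φ z| ≤ 2) (hL : ∀ z, |φ z| ≤ L * (1 + |z|)) (hd : ∀ z, |deriv φ z| ≤ L)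
    {μ ν : Measure ℝ} [IsProbabilityMeasure μ] [IsProbabilityMeasure ν] {d : ℝ}
    (h : KolmogorovLE μ ν d) :
    |∫ z, potential a z * φ z ∂μ - ∫ z, potential a z * φ z ∂ν| ≤
        d * (L * variationBound ρ σ c) ∧
      |∫ z, potential a z * φ z ∂μ| ≤ L * variationBound ρ σ c := by
  have ha : 0 < a := hc.trans_le hca
  have hL0 : 0 ≤ L := (abs_nonneg _).trans (hd 0)
  set g := fun z => potential a z * φ z with hg
  set k := fun z => -(a * z) * potential a z * φ z + potential a z * deriv φ z with hk
  have hder : ∀ z, HasDerivAt g (k z) z := fun z =>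
    (hasDerivAt_potential a z).mul (hφ z).hasDerivAt
  have hkb : ∀ z, |k z| ≤
      L * ((1 + 2 * curvatureBound ρ σ c) * ((1 + z ^ 2) * potential c z)) := by
    intro z
    have hp := potential_pos a z
    have h1 : |k z| ≤ a * |z| * potential a z * (L * (1 + |z|)) + potential a z * L := by
      refine (abs_add_le _ _).trans (add_le_add ?_ ?_)
      · rw [abs_mul, abs_mul, abs_neg, abs_mul, abs_of_pos ha, abs_of_pos hp]
        gcongr
        exact hL z
      · rw [abs_mul, abs_of_pos hp]
        gcongr
        exact hd z
    have h2 : a * |z| * potential a z * (L * (1 + |z|)) + potential a z * L =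
        L * potential a z * (a * (|z| + |z| ^ 2) + 1) := by ring
    have h3 : a * (|z| + |z| ^ 2) + 1 ≤ (1 + 2 * curvatureBound ρ σ c) * (1 + z ^ 2) := by
      rw [sq_abs]
      have h4 : |z| + z ^ 2 ≤ 2 * (1 + z ^ 2) := by
        nlinarith [sq_nonneg (|z| - 1), sq_abs z]
      have h5 : a * (|z| + z ^ 2) ≤ curvatureBound ρ σ c * (2 * (1 + z ^ 2)) :=
        mul_le_mul haA h4 (by positivity) (by linarith)
      nlinarith [sq_nonneg z]
    calc |k z| ≤ L * potential a z * (a * (|z| + |z| ^ 2) + 1) := h2 ▸ h1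
      _ ≤ L * potential c z * ((1 + 2 * curvatureBound ρ σ c) * (1 + z ^ 2)) := by
          have := potential_anti hca z
          have := (potential_pos c z).le
          gcongr
      _ = _ := by ring
  have hdom := ((integrable_one_add_sq_mul_potential hc).const_mul
    (1 + 2 * curvatureBound ρ σ c)).const_mul L
  have hkm : Measurable k := by
    have := hφ.continuous.measurable
    have := measurable_deriv φ
    fun_prop
  have hki : Integrable k := hdom.mono' hkm.aestronglyMeasurable (Filter.Eventually.of_forall hkb)
  have hvar : ∫ z, |k z| ≤ L * variationBound ρ σ c := by
    rw [variationBound, ← integral_const_mul]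
    exact integral_mono hki.abs hdom hkb
  have hlim : Filter.Tendsto g Filter.atTop (nhds 0) := by
    refine squeeze_zero_norm (a := fun z => potential a z * 2) (fun z => ?_) ?_
    · rw [Real.norm_eq_abs, abs_mul, abs_of_pos (potential_pos a z)]
      exact mul_le_mul_of_nonneg_left (hb z) (potential_pos a z).le
    · simpa using (tendsto_potential_atTop ha).mul_const 2
  have hrep : ∀ t, g t = - ∫ y in Set.Ici t, k y := by
    intro t
    rw [integral_Ici_eq_integral_Ioi, integral_Ioi_of_hasDerivAt_of_tendsto
      (hder t).continuousAt.continuousWithinAt (fun x _ => hder x) hki.integrableOn hlim]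
    ring
  refine ⟨?_, ?_⟩
  · refine (h.abs_integral_sub_le (f := g) (α := 0) (x := 0) hki fun t => ?_).trans ?_
    · rw [hrep]
      simp
    · rw [abs_zero, zero_add]
      exact mul_le_mul_of_nonneg_left hvar h.nonneg
  · have hsup : ∀ t, ‖g t‖ ≤ L * variationBound ρ σ c := by
      intro t
      rw [hrep, norm_neg]
      refine (norm_integral_le_integral_norm _).trans (le_trans ?_ hvar)
      exact setIntegral_le_integral hki.abs (Filter.Eventually.of_forall fun y => abs_nonneg _)
    have := norm_integral_le_of_norm_le_const (μ := μ) (Filter.Eventually.of_forall hsup)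
    simpa using this

lemma abs_integral_potential_sub_le (hc : 0 < c) {a : ℝ} (hca : c ≤ a)
    (haA : a ≤ curvatureBound ρ σ c) {μ ν : Measure ℝ} [IsProbabilityMeasure μ]
    [IsProbabilityMeasure ν] {d : ℝ} (h : KolmogorovLE μ ν d) :
    |∫ z, potential a z ∂μ - ∫ z, potential a z ∂ν| ≤ d * variationBound ρ σ c := by
  have := (abs_integral_potential_mul_le (L := 1) hc hca haA (differentiable_const (1 : ℝ))
    (fun z => by norm_num) (fun z => by simp) (fun z => by simp) h).1
  simpa using this

/-- The Lipschitz constant of the iterated predictive step is this number times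
`√θ ^ k / κ ^ 2`. -/
def contractionConstant (ρ σ c : ℝ) : ℝ :=
  |ρ| * (√(2 * Real.pi * (σ ^ 2).toNNReal))⁻¹ * √(curvatureBound ρ σ c / c) *
    (variationBound ρ σ c + variationBound ρ σ c ^ 2)

lemma contractionConstant_nonneg (hc : 0 < c) : 0 ≤ contractionConstant ρ σ c := by
  have := variationBound_nonneg (ρ := ρ) (σ := σ) hc
  unfold contractionConstant
  positivity

lemma isProbabilityMeasure_iterate_predictiveStep (ρ σ : ℝ) (hc : 0 ≤ c) (k : ℕ)
    (μ : Measure ℝ) [IsProbabilityMeasure μ] :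
    IsProbabilityMeasure ((predictiveStep ρ σ c)^[k] μ) := by
  induction k generalizing μ with
  | zero => assumption
  | succ k ih =>
    have := isProbabilityMeasure_predictiveStep ρ σ hc μ
    exact ih _

/-- Exponential stability of the exact filter in Kolmogorov distance, for initial laws that do not
put almost all their mass near infinity. -/
lemma kolmogorovLE_iterate_predictiveStep (hσ : 0 < σ) (hc : 0 < c) {μ ν : Measure ℝ}
    [IsProbabilityMeasure μ] [IsProbabilityMeasure ν] {d κ : ℝ} (h : KolmogorovLE μ ν d)
    (hκ : 0 < κ) (hκ1 : κ ≤ 1) (hμ : κ ≤ ∫ z, potential (curvatureBound ρ σ c) z ∂μ)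
    (hν : κ ≤ ∫ z, potential (curvatureBound ρ σ c) z ∂ν) (k : ℕ) :
    KolmogorovLE ((predictiveStep ρ σ c)^[k + 1] μ) ((predictiveStep ρ σ c)^[k + 1] ν)
      (contractionConstant ρ σ c / κ ^ 2 * √(contractionRate ρ σ c) ^ k * d) := by
  intro x
  obtain ⟨a, L, hca, haA, hL0, hL2, hrep⟩ := exists_smooth_representation (ρ := ρ) hσ hc k
  obtain ⟨ψ, hψ, hrep⟩ := hrep x
  have ha := hc.trans_le hca
  have hd := h.nonneg
  have hI := variationBound_nonneg (ρ := ρ) (σ := σ) hc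
  set I := variationBound ρ σ c
  set A := curvatureBound ρ σ c
  have hmass : ∀ π : Measure ℝ, IsProbabilityMeasure π → κ ≤ ∫ z, potential A z ∂π →
      κ ≤ ∫ z, potential a z ∂π := fun π _ hπ => hπ.trans
    (integral_mono (integrable_potential (ha.le.trans haA) π) (integrable_potential ha.le π)
      (potential_anti haA))
  have hμa := hmass μ inferInstance hμ
  have hνa := hmass ν inferInstance hν
  -- Subtracting the constant `ψ 0` leaves the difference of the two ratios unchanged.
  set φ := fun z => ψ z - ψ 0 with hφ
  have hratio : ∀ π : Measure ℝ, IsProbabilityMeasure π → κ ≤ ∫ z, potential a z ∂π →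
      (∫ z, potential a z * ψ z ∂π) / ∫ z, potential a z ∂π =
        (∫ z, potential a z * φ z ∂π) / (∫ z, potential a z ∂π) + ψ 0 := by
    intro π _ hπ
    have hi := integrable_potential ha.le π
    have hψi : Integrable (fun z => potential a z * ψ z) π :=
      hi.mul_bdd (c := 1) hψ.differentiable.continuous.aestronglyMeasurable
        (Filter.Eventually.of_forall hψ.abs_le_one)
    simp_rw [hφ, mul_sub]
    rw [integral_sub hψi (hi.mul_const _), integral_mul_const]
    have : ∫ z, potential a z ∂π ≠ 0 := (hκ.trans_le hπ).ne'
    field_simp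
    ring
  have hφd : Differentiable ℝ φ := hψ.differentiable.sub_const _
  have hφ' : ∀ z, deriv φ z = deriv ψ z := fun z => by
    rw [hφ]
    exact deriv_sub_const _
  have hlip : ∀ z, |φ z| ≤ L * |z| := fun z => by
    have := Convex.norm_image_sub_le_of_norm_deriv_le (s := Set.univ) (f := ψ) (C := L)
      (fun x _ => hψ.differentiable x) (fun x _ => hψ.abs_deriv_le x) convex_univ
      (Set.mem_univ 0) (Set.mem_univ z)
    simpa using this
  have hφb : ∀ z, |φ z| ≤ 2 := fun z => by
    have h1 := hψ.abs_le_one z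
    have h2 := hψ.abs_le_one 0
    calc |φ z| ≤ |ψ z| + |ψ 0| := abs_sub _ _
      _ ≤ 2 := by linarith
  have hφL : ∀ z, |φ z| ≤ L * (1 + |z|) := fun z => (hlip z).trans (by nlinarith)
  have hφd' : ∀ z, |deriv φ z| ≤ L := fun z => by
    rw [hφ']
    exact hψ.abs_deriv_le z
  have hnum := (abs_integral_potential_mul_le hc hca haA hφd hφb hφL hφd' h).1
  have hnumν := (abs_integral_potential_mul_le hc hca haA hφd hφb hφL hφd' h.symm).2
  have hden := abs_integral_potential_sub_le hc hca haA h.symm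
  rw [hrep μ inferInstance, hrep ν inferInstance, hratio μ inferInstance hμa,
    hratio ν inferInstance hνa, add_sub_add_right_eq_sub]
  set m := ∫ z, potential a z ∂μ
  set n := ∫ z, potential a z ∂ν
  set p := ∫ z, potential a z * φ z ∂μ
  set r := ∫ z, potential a z * φ z ∂ν
  have hm : 0 < m := hκ.trans_le hμa
  have hn : 0 < n := hκ.trans_le hνa
  have hLB : L ≤ |ρ| * (√(2 * Real.pi * (σ ^ 2).toNNReal))⁻¹ * √(A / c) *
      √(contractionRate ρ σ c) ^ k := by
    refine (sq_le_sq₀ hL0 (by positivity)).1 (hL2.trans ?_)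
    have hθ := contractionRate_nonneg ρ σ hc
    have hA : 0 < A := ha.trans_le haA
    rw [mul_pow _ (√(contractionRate ρ σ c) ^ k), mul_pow _ (√(A / c)), ← pow_mul,
      mul_comm k 2, pow_mul, Real.sq_sqrt hθ, Real.sq_sqrt (by positivity)]
    gcongr
  calc |p / m - r / n| = |(p - r) / m + r * (n - m) / (m * n)| := by
        congr 1
        field_simp
        ring
    _ ≤ |p - r| / m + |r| * |n - m| / (m * n) := by
        refine (abs_add_le _ _).trans (le_of_eq ?_)
        rw [abs_div, abs_div, abs_mul, abs_of_pos hm, abs_of_pos (mul_pos hm hn)]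
    _ ≤ d * (L * I) / κ ^ 2 + L * I * (d * I) / κ ^ 2 := by
        have h1 : κ ^ 2 ≤ m := by nlinarith
        have h2 : κ ^ 2 ≤ m * n := by nlinarith
        gcongr
    _ = L * ((I + I ^ 2) * d / κ ^ 2) := by ring
    _ ≤ _ * ((I + I ^ 2) * d / κ ^ 2) := mul_le_mul_of_nonneg_right hLB (by positivity)
    _ = _ := by
        unfold contractionConstant
        ring

/-- The Bayes update is Lipschitz in Kolmogorov distance. -/
lemma kolmogorovLE_bayesUpdate (hc : 0 < c) {μ ν : Measure ℝ} [IsProbabilityMeasure μ]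
    [IsProbabilityMeasure ν] {d κ : ℝ} (h : KolmogorovLE μ ν d) (hκ : 0 < κ) (hκ1 : κ ≤ 1)
    (hμ : κ ≤ ∫ z, potential c z ∂μ) (hν : κ ≤ ∫ z, potential c z ∂ν) :
    KolmogorovLE (bayesUpdate c μ) (bayesUpdate c ν)
      ((1 + 2 * variationBound ρ σ c) / κ ^ 2 * d) := by
  intro x
  have hd := h.nonneg
  have hI := variationBound_nonneg (ρ := ρ) (σ := σ) hc
  set I := variationBound ρ σ c
  rw [cdf_bayesUpdate hc.le, cdf_bayesUpdate hc.le]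
  have hden := abs_integral_potential_sub_le hc le_rfl (le_curvatureBound ρ σ c) h.symm
  have hnum : |∫ y in Set.Iic x, potential c y ∂μ - ∫ y in Set.Iic x, potential c y ∂ν| ≤
      d * (1 + I) := by
    set k := (Set.Iic x).indicator fun y => -(c * y) * potential c y with hk
    have hkb : ∀ z, |k z| ≤ (1 + 2 * curvatureBound ρ σ c) * ((1 + z ^ 2) * potential c z) := by
      intro z
      have hp := potential_pos c z
      have hA := le_curvatureBound ρ σ c
      have h1 : |k z| ≤ |-(c * z) * potential c z| :=
        norm_indicator_le_norm_self (fun y => -(c * y) * potential c y) z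
      refine h1.trans ?_
      rw [abs_mul, abs_neg, abs_mul, abs_of_pos hc, abs_of_pos hp, ← mul_assoc]
      gcongr
      · linarith
      · linarith
      · nlinarith [sq_nonneg (|z| - 1), sq_abs z]
    have hdom := (integrable_one_add_sq_mul_potential hc).const_mul
      (1 + 2 * curvatureBound ρ σ c)
    have hkm : Measurable k := Measurable.indicator (by fun_prop) measurableSet_Iic
    have hki : Integrable k :=
      hdom.mono' hkm.aestronglyMeasurable (Filter.Eventually.of_forall hkb)
    have := h.abs_integral_sub_le (f := (Set.Iic x).indicator (potential c))
      (α := potential c x) (x := x) hki fun t => ?_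
    · rw [integral_indicator measurableSet_Iic, integral_indicator measurableSet_Iic] at this
      refine this.trans (mul_le_mul_of_nonneg_left (add_le_add ?_ ?_) hd)
      · rw [abs_of_pos (potential_pos c x)]
        exact potential_le_one hc.le x
      · exact integral_mono hki.abs hdom hkb
    · rw [integral_Ici_eq_integral_Ioi, hk, setIntegral_indicator measurableSet_Iic,
        Set.Ioi_inter_Iic]
      by_cases ht : t ≤ x
      · rw [← intervalIntegral.integral_of_le ht,
          intervalIntegral.integral_eq_sub_of_hasDerivAt (f := potential c)
            (fun y _ => hasDerivAt_potential c y)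
            (Continuous.intervalIntegrable (by fun_prop) _ _)]
        simp [Set.indicator, ht]
      · rw [Set.Ioc_eq_empty (by
          intro h
          exact ht h.le)]
        simp [Set.indicator, ht]
  have hle : ∫ y in Set.Iic x, potential c y ∂ν ≤ ∫ y, potential c y ∂ν :=
    setIntegral_le_integral (integrable_potential hc.le ν)
      (Filter.Eventually.of_forall fun y => (potential_pos c y).le)
  have h0 : 0 ≤ ∫ y in Set.Iic x, potential c y ∂ν :=
    integral_nonneg fun y => (potential_pos c y).le
  set m := ∫ z, potential c z ∂μ
  set n := ∫ z, potential c z ∂ν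
  set p := ∫ y in Set.Iic x, potential c y ∂μ
  set r := ∫ y in Set.Iic x, potential c y ∂ν
  have hm : 0 < m := hκ.trans_le hμ
  have hn : 0 < n := hκ.trans_le hν
  calc |p / m - r / n| = |(p - r) / m + r / n * (n - m) / m| := by
        congr 1
        field_simp
        ring
    _ ≤ |p - r| / m + r / n * |n - m| / m := by
        refine (abs_add_le _ _).trans (le_of_eq ?_)
        rw [abs_div, abs_div, abs_mul, abs_of_pos hm, abs_of_nonneg (div_nonneg h0 hn.le)]
    _ ≤ d * (1 + I) / κ ^ 2 + 1 * (d * I) / κ ^ 2 := by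
        have h1 : κ ^ 2 ≤ m := by nlinarith
        have h2 : r / n ≤ 1 := (div_le_one hn).2 hle
        gcongr
    _ = _ := by ring

end

/-! ### Tightness and propagation of local errors -/

section
variable {ρ σ c : ℝ}

lemma bayesUpdate_gaussianReal {s : ℝ} (hc : 0 ≤ c) (hs : 0 < s) :
    bayesUpdate c (gaussianReal 0 s.toNNReal) = gaussianReal 0 (s / (1 + c * s)).toNNReal := by
  have h1 : 0 < 1 + c * s := by positivity
  have := isProbabilityMeasure_bayesUpdate hc (gaussianReal 0 s.toNNReal)
  refine Measure.eq_of_cdf _ _ (StieltjesFunction.ext fun x => ?_)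
  have e := integral_potential_mul_gaussianReal hc hs 0 fun _ => 1
  simp only [mul_one, integral_const, probReal_univ, smul_eq_mul] at e
  rw [cdf_eq_real, cdf_eq_real, ← integral_indicator_one measurableSet_Iic,
    ← integral_indicator_one measurableSet_Iic, integral_bayesUpdate hc,
    integral_potential_mul_gaussianReal hc hs, e, zero_div, mul_div_cancel_left₀]
  have := potential_pos (c / (1 + c * s)) 0
  positivity

lemma bind_transition_gaussianReal {s : ℝ} (hs : 0 ≤ s) :
    (gaussianReal 0 s.toNNReal).bind (transition ρ σ) =
      gaussianReal 0 (ρ ^ 2 * s + σ ^ 2).toNNReal := by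
  have e : gaussianReal 0 (ρ ^ 2 * s + σ ^ 2).toNNReal =
      ((gaussianReal 0 s.toNNReal).map fun z => ρ * z).conv
        (gaussianReal 0 (σ ^ 2).toNNReal) := by
    rw [gaussianReal_map_const_mul, gaussianReal_conv_gaussianReal]
    congr 1
    · simp
    · ext
      push_cast
      rw [Real.coe_toNNReal _ (by positivity), Real.coe_toNNReal _ hs,
        Real.coe_toNNReal _ (by positivity)]
  rw [e]
  ext A hA
  rw [Measure.bind_apply hA (Kernel.aemeasurable _), Measure.conv,
    Measure.map_apply (by fun_prop) hA,
    Measure.prod_apply (measurableSet_preimage (by fun_prop) hA),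
    lintegral_map (measurable_measure_prodMk_left
      (measurableSet_preimage (by fun_prop) hA)) (by fun_prop)]
  refine lintegral_congr fun z => ?_
  change gaussianReal (ρ * z) (σ ^ 2).toNNReal A = _
  have h := gaussianReal_map_const_add (μ := 0) (v := (σ ^ 2).toNNReal) (ρ * z)
  rw [zero_add] at h
  rw [← h, Measure.map_apply (by fun_prop) hA]
  rfl

/-- The predictive step has a Gaussian fixed point, whose variance solves a quadratic equation. -/
lemma exists_predictiveStep_fixed (ρ : ℝ) (hσ : 0 < σ) (hc : 0 < c) :
    ∃ ν : Measure ℝ, IsProbabilityMeasure ν ∧ predictiveStep ρ σ c ν = ν := by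
  obtain ⟨s, hs, hfix⟩ : ∃ s : ℝ, 0 < s ∧ ρ ^ 2 * (s / (1 + c * s)) + σ ^ 2 = s := by
    set b := 1 - ρ ^ 2 - c * σ ^ 2
    have hpos : 0 < b ^ 2 + 4 * c * σ ^ 2 := by positivity
    have hsq := Real.sq_sqrt hpos.le
    have hlt : b < √(b ^ 2 + 4 * c * σ ^ 2) := by
      refine (le_abs_self b).trans_lt ?_
      rw [← Real.sqrt_sq_eq_abs]
      exact Real.sqrt_lt_sqrt (sq_nonneg b) (lt_add_of_pos_right _ (by positivity))
    set r := √(b ^ 2 + 4 * c * σ ^ 2)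
    have hs : 0 < (r - b) / (2 * c) := div_pos (by linarith) (by positivity)
    refine ⟨(r - b) / (2 * c), hs, ?_⟩
    have hq : c * ((r - b) / (2 * c)) ^ 2 + b * ((r - b) / (2 * c)) - σ ^ 2 = 0 := by
      field_simp
      linarith
    set s := (r - b) / (2 * c)
    have h1 : 0 < 1 + c * s := by positivity
    have hb : b = 1 - ρ ^ 2 - c * σ ^ 2 := rfl
    rw [hb] at hq
    field_simp
    linarith
  refine ⟨gaussianReal 0 s.toNNReal, inferInstance, ?_⟩
  unfold predictiveStep
  rw [bayesUpdate_gaussianReal hc.le hs, bind_transition_gaussianReal (by positivity), hfix]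

/-- The exact predictive distributions are tight uniformly in time: they converge to the Gaussian
fixed point. -/
lemma exists_le_integral_potential_iterate (hσ : 0 < σ) (hc : 0 < c) (η : Measure ℝ)
    [IsProbabilityMeasure η] :
    ∃ κ : ℝ, 0 < κ ∧ κ ≤ 1 ∧
      ∀ k, κ ≤ ∫ z, potential (curvatureBound ρ σ c) z ∂((predictiveStep ρ σ c)^[k] η) := by
  obtain ⟨ν, _, hν⟩ := exists_predictiveStep_fixed ρ hσ hc
  have hA := (hc.trans_le (le_curvatureBound ρ σ c)).le
  have hprob := fun k => isProbabilityMeasure_iterate_predictiveStep ρ σ hc.le k η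
  set u := fun k => ∫ z, potential (curvatureBound ρ σ c) z ∂((predictiveStep ρ σ c)^[k] η)
  have hupos : ∀ k, 0 < u k := fun k => integral_potential_pos hA _
  have hle1 : ∀ k, u k ≤ 1 := fun k => by
    have := integral_mono (integrable_potential hA ((predictiveStep ρ σ c)^[k] η))
      (integrable_const (1 : ℝ)) (potential_le_one hA)
    simpa using this
  have hn := integral_potential_pos hA ν
  set n := ∫ z, potential (curvatureBound ρ σ c) z ∂ν
  have hlim : Filter.Tendsto (fun k => u (k + 1)) Filter.atTop (nhds n) := by
    rw [tendsto_iff_norm_sub_tendsto_zero]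
    refine squeeze_zero (fun k => norm_nonneg _) (g := fun k =>
      contractionConstant ρ σ c / min (u 0) n ^ 2 * √(contractionRate ρ σ c) ^ k * 1 *
        variationBound ρ σ c) (fun k => ?_) ?_
    · have h := kolmogorovLE_iterate_predictiveStep hσ hc (kolmogorovLE_one η ν)
        (lt_min (hupos 0) hn) ((min_le_left _ _).trans (hle1 0)) (min_le_left _ _)
        (min_le_right _ _) k
      rw [Function.iterate_fixed hν] at h
      exact abs_integral_potential_sub_le hc (le_curvatureBound ρ σ c) le_rfl h
    · have hlt : √(contractionRate ρ σ c) < 1 := by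
        rw [Real.sqrt_lt' one_pos]
        simpa using contractionRate_lt_one ρ σ hc
      have := tendsto_pow_atTop_nhds_zero_of_lt_one (Real.sqrt_nonneg _) hlt
      simpa using ((this.const_mul (contractionConstant ρ σ c / min (u 0) n ^ 2)).mul_const
        1).mul_const (variationBound ρ σ c)
  have hlim' : Filter.Tendsto u Filter.atTop (nhds n) :=
    (Filter.tendsto_add_atTop_iff_nat 1).1 hlim
  obtain ⟨M, hM⟩ := (hlim'.inv₀ hn.ne').bddAbove_range
  have hM' : ∀ k, (u k)⁻¹ ≤ M := fun k => hM ⟨k, rfl⟩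
  have hMpos : 0 < M := (inv_pos.2 (hupos 0)).trans_le (hM' 0)
  have key : ∀ k, M⁻¹ ≤ u k := fun k => inv_le_of_inv_le₀ (hupos k) (hM' k)
  exact ⟨M⁻¹, inv_pos.2 hMpos, (key 0).trans (hle1 0), key⟩

/-- Propagation of local errors: if each `μ (k + 1)` is close to the image of `μ k` under the exact
predictive step, then the `μ k` stay close to the exact predictive distributions, uniformly in
time. Smallness of the local errors keeps the `μ k` tight, which the exponential stability needs. -/
lemma exists_error_propagation (ρ : ℝ) (hσ : 0 < σ) (hc : 0 < c) (η : Measure ℝ)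
    [IsProbabilityMeasure η] :
    ∃ S ε₀ : ℝ, 0 < S ∧ 0 < ε₀ ∧ ∀ (μ : ℕ → Measure ℝ) (T : ℕ) (ε : ℝ),
      (∀ k, IsProbabilityMeasure (μ k)) → ε ≤ ε₀ → KolmogorovLE (μ 0) η ε →
      (∀ k, k + 1 < T → KolmogorovLE (μ (k + 1)) (predictiveStep ρ σ c (μ k)) ε) →
      ∀ k < T, KolmogorovLE (μ k) ((predictiveStep ρ σ c)^[k] η) (S * ε) ∧
        KolmogorovLE (bayesUpdate c (μ k)) (bayesUpdate c ((predictiveStep ρ σ c)^[k] η))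
          (S * ε) := by
  obtain ⟨κ, hκ, hκ1, hη⟩ := exists_le_integral_potential_iterate (ρ := ρ) hσ hc η
  have hAc := le_curvatureBound ρ σ c
  have hprob := fun k => isProbabilityMeasure_iterate_predictiveStep ρ σ hc.le k η
  have hI := variationBound_nonneg (ρ := ρ) (σ := σ) hc
  set I := variationBound ρ σ c
  have hlt : √(contractionRate ρ σ c) < 1 := by
    rw [Real.sqrt_lt' one_pos]
    simpa using contractionRate_lt_one ρ σ hc
  have hl0 := Real.sqrt_nonneg (contractionRate ρ σ c)
  set l := √(contractionRate ρ σ c) with hl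
  have hB := contractionConstant_nonneg (ρ := ρ) (σ := σ) hc
  set D := contractionConstant ρ σ c / (κ / 2) ^ 2 with hD
  have hD0 : 0 ≤ D := by positivity
  have h1l : 0 < 1 - l := by linarith
  set S := 1 + D * (1 - l)⁻¹ with hS
  have hS1 : 1 ≤ S := le_add_of_nonneg_right (by positivity)
  have hS0 : 0 < S := by linarith
  set ε₀ := κ / (4 * S * (I + 1)) with hε₀
  set R := (1 + 2 * I) / (κ / 2) ^ 2
  have hR : 0 < R := by positivity
  refine ⟨max S (R * S), ε₀, by positivity, by positivity, ?_⟩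
  intro μ T ε hμ hε h0 hstep
  have hε0 : 0 ≤ ε := h0.nonneg
  have hsmall : S * ε * I ≤ κ / 4 := by
    calc S * ε * I ≤ S * ε₀ * (I + 1) := by
          gcongr
          linarith
      _ = κ / 4 := by
          rw [hε₀]
          field_simp
  have hsmall' : ε * I ≤ κ / 4 := le_trans (by nlinarith [mul_nonneg hε0 hI]) hsmall
  have mass : ∀ k, KolmogorovLE (μ k) ((predictiveStep ρ σ c)^[k] η) (S * ε) →
      3 * κ / 4 ≤ ∫ z, potential (curvatureBound ρ σ c) z ∂(μ k) := by
    intro k h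
    have := abs_integral_potential_sub_le hc hAc le_rfl h
    have := (abs_le.1 this).1
    have := hη k
    linarith
  have main : ∀ t < T, KolmogorovLE (μ t) ((predictiveStep ρ σ c)^[t] η) (S * ε) := by
    intro t
    induction t using Nat.strong_induction_on with
    | h t ih =>
    intro ht
    -- `ξ k` is the law that `μ k` approximates with the local error `ε`.
    set ξ : ℕ → Measure ℝ := fun k => Nat.casesOn k η fun j => predictiveStep ρ σ c (μ j)
      with hξ
    have hξprob : ∀ k, IsProbabilityMeasure (ξ k) := by
      rintro (_ | k)
      · assumption
      · exact isProbabilityMeasure_predictiveStep ρ σ hc.le (μ k)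
    have hloc : ∀ k < T, KolmogorovLE (μ k) (ξ k) ε := by
      rintro (_ | k) hk
      · exact h0
      · exact hstep k hk
    have htel : ∀ j ≤ t, KolmogorovLE ((predictiveStep ρ σ c)^[t - j] (ξ j))
        ((predictiveStep ρ σ c)^[t] η) (∑ i ∈ Finset.range j, D * l ^ (t - 1 - i) * ε) := by
      intro j
      induction j with
      | zero =>
        intro _
        rw [Finset.sum_range_zero]
        exact kolmogorovLE_refl ((predictiveStep ρ σ c)^[t] η)
      | succ j ihj =>
        intro hj
        have hjt : j < t := hj
        have hm := mass j (ih j hjt (hjt.trans ht))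
        have hlj := hloc j (hjt.trans ht)
        have hm' := (abs_le.1 (abs_integral_potential_sub_le (ρ := ρ) (σ := σ) hc hAc le_rfl
          hlj)).2
        have hcontr := kolmogorovLE_iterate_predictiveStep (ρ := ρ) (κ := κ / 2) hσ hc hlj
          (by linarith) (by linarith) (by linarith) (by linarith) (t - 1 - j)
        have e1 : t - 1 - j + 1 = t - j := by lia
        have e2 : (predictiveStep ρ σ c)^[t - (j + 1)] (ξ (j + 1)) =
            (predictiveStep ρ σ c)^[t - j] (μ j) := by
          rw [show t - j = (t - (j + 1)) + 1 by lia, Function.iterate_succ_apply]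
        rw [e1] at hcontr
        rw [e2, Finset.sum_range_succ, add_comm]
        exact hcontr.trans (ihj hjt.le)
    have h1 := (hloc t ht).trans (by simpa using htel t le_rfl)
    refine h1.mono ?_
    have hsum : ∑ i ∈ Finset.range t, D * l ^ (t - 1 - i) * ε ≤ D * (1 - l)⁻¹ * ε := by
      rw [← Finset.sum_mul, ← Finset.mul_sum,
        Finset.sum_range_reflect (fun i => l ^ i) t]
      gcongr
      rw [← tsum_geometric_of_lt_one hl0 hlt]
      exact (summable_geometric_of_lt_one hl0 hlt).sum_le_tsum _ fun i _ => by positivity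
    rw [hS, add_mul, one_mul]
    linarith
  intro k hk
  have hk' := main k hk
  refine ⟨hk'.mono (mul_le_mul_of_nonneg_right (le_max_left _ _) hε0), ?_⟩
  have hle : ∀ π : Measure ℝ, IsProbabilityMeasure π →
      ∫ z, potential (curvatureBound ρ σ c) z ∂π ≤ ∫ z, potential c z ∂π := fun π _ =>
    integral_mono (integrable_potential (hc.le.trans hAc) π) (integrable_potential hc.le π)
      (potential_anti hAc)
  have hb := kolmogorovLE_bayesUpdate (ρ := ρ) (σ := σ) (κ := κ / 2) hc hk' (by linarith)
    (by linarith) (by linarith [mass k hk', hle (μ k) inferInstance])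
    (by linarith [hη k, hle _ (hprob k)])
  refine hb.mono ?_
  rw [← mul_assoc]
  exact mul_le_mul_of_nonneg_right (le_max_right _ _) hε0

end

/-! ### The exact filter and the empirical measures -/

lemma bind_unnormalizedKernel (ρ σ c : ℝ) (m : Measure ℝ) :
    m.bind (unnormalizedKernel ρ σ c) =
      (m.bind (transition ρ σ)).withDensity fun x => ENNReal.ofReal (potential c x) := by
  ext A hA
  have hG : Measurable fun x => ENNReal.ofReal (potential c x) := by fun_prop
  rw [Measure.bind_apply hA (Kernel.aemeasurable _), withDensity_apply _ hA,
    ← lintegral_indicator hA, Measure.lintegral_bind (Kernel.aemeasurable _)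
      (hG.indicator hA).aemeasurable]
  refine lintegral_congr fun z => ?_
  rw [unnormalizedKernel, Kernel.withDensity_apply' _
    (show Measurable (Function.uncurry fun _ x : ℝ => ENNReal.ofReal (potential c x)) from
      hG.comp measurable_snd), lintegral_indicator hA]

lemma filteringDist_eq_and_predictiveDist_eq (ρ σ : ℝ) {c : ℝ} (hc : 0 ≤ c) (η : Measure ℝ)
    [IsProbabilityMeasure η] (k : ℕ) :
    filteringDist ρ σ c η k = bayesUpdate c ((predictiveStep ρ σ c)^[k] η) ∧
      predictiveDist ρ σ c η k = (predictiveStep ρ σ c)^[k] η := by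
  induction k with
  | zero =>
    have := isProbabilityMeasure_bayesUpdate hc η
    refine ⟨?_, rfl⟩
    change normalizeMeasure ((bayesUpdate c η).bind (Kernel.id : Kernel ℝ ℝ)) = _
    rw [Measure.id_comp, normalizeMeasure]
    simp
  | succ k ih =>
    obtain ⟨ih1, -⟩ := ih
    have hpred : predictiveDist ρ σ c η (k + 1) = (predictiveStep ρ σ c)^[k + 1] η := by
      rw [Function.iterate_succ_apply']
      change (filteringDist ρ σ c η k).bind (transition ρ σ) = _
      rw [ih1]
      rfl
    refine ⟨?_, hpred⟩
    rw [← hpred]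
    change _ = bayesUpdate c ((filteringDist ρ σ c η k).bind (transition ρ σ))
    have := isProbabilityMeasure_iterate_predictiveStep ρ σ hc k η
    have hprob : IsProbabilityMeasure (filteringDist ρ σ c η k) := by
      rw [ih1]
      exact isProbabilityMeasure_bayesUpdate hc _
    have hbind : (filteringInit c η).bind (unnormalizedKernel ρ σ c ^ (k + 1)) =
        ((filteringInit c η).bind (unnormalizedKernel ρ σ c ^ k)).bind
          (unnormalizedKernel ρ σ c) := by
      rw [Measure.comp_assoc, pow_succ']
      rfl
    unfold filteringDist at hprob ⊢
    rw [hbind]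
    set m := (filteringInit c η).bind (unnormalizedKernel ρ σ c ^ k)
    have h0 : m Set.univ ≠ 0 := fun h => by
      have := hprob.measure_univ
      simp [normalizeMeasure, h] at this
    have ht : m Set.univ ≠ ⊤ := fun h => by
      have := hprob.measure_univ
      simp [normalizeMeasure, h] at this
    have hm : m = m Set.univ • normalizeMeasure m := by
      rw [normalizeMeasure, smul_smul, ENNReal.mul_inv_cancel h0 ht, one_smul]
    conv_lhs => rw [hm, Measure.bind_smul, normalizeMeasure_smul h0 ht, bind_unnormalizedKernel]
    rfl

section
variable {N : ℕ}

lemma isProbabilityMeasure_empirical (hN : 1 ≤ N) (x : Fin N → ℝ) :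
    IsProbabilityMeasure (empirical x) := by
  constructor
  simp only [empirical, Measure.smul_apply, Measure.finsetSum_apply, measure_univ,
    Finset.sum_const, Finset.card_univ, Fintype.card_fin, nsmul_eq_mul, mul_one, smul_eq_mul]
  exact ENNReal.inv_mul_cancel (by positivity) (ENNReal.natCast_ne_top N)

lemma sum_potential_pos (hN : 1 ≤ N) (c : ℝ) (x : Fin N → ℝ) : 0 < ∑ m, potential c (x m) :=
  Finset.sum_pos (fun n _ => potential_pos c (x n)) ⟨⟨0, hN⟩, Finset.mem_univ _⟩

lemma weight_nonneg (c : ℝ) (x : Fin N → ℝ) (n : Fin N) : 0 ≤ weight c x n :=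
  div_nonneg (potential_pos _ _).le (Finset.sum_nonneg fun m _ => (potential_pos c (x m)).le)

lemma isProbabilityMeasure_weightedEmpirical (hN : 1 ≤ N) (c : ℝ) (x : Fin N → ℝ) :
    IsProbabilityMeasure (weightedEmpirical c x) := by
  constructor
  simp only [weightedEmpirical, Measure.finsetSum_apply, Measure.smul_apply, measure_univ,
    smul_eq_mul, mul_one]
  rw [← ENNReal.ofReal_sum_of_nonneg fun n _ => weight_nonneg c x n]
  unfold weight
  rw [← Finset.sum_div, div_self (sum_potential_pos hN c x).ne', ENNReal.ofReal_one]

lemma integral_empirical (x : Fin N → ℝ) (f : ℝ → ℝ) :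
    ∫ y, f y ∂(empirical x) = (N : ℝ)⁻¹ * ∑ n, f (x n) := by
  rw [empirical, integral_smul_measure, integral_finsetSum_measure fun n _ => integrable_dirac
    (by simp)]
  simp

lemma integral_weightedEmpirical (c : ℝ) (x : Fin N → ℝ) (f : ℝ → ℝ) :
    ∫ y, f y ∂(weightedEmpirical c x) = ∑ n, weight c x n * f (x n) := by
  rw [weightedEmpirical, integral_finsetSum_measure fun n _ =>
    (integrable_dirac (by simp)).smul_measure ENNReal.ofReal_ne_top]
  refine Finset.sum_congr rfl fun n _ => ?_
  rw [integral_smul_measure, integral_dirac, ENNReal.toReal_ofReal (weight_nonneg c x n),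
    smul_eq_mul]

lemma cdf_empirical (hN : 1 ≤ N) (x : Fin N → ℝ) (a : ℝ) :
    cdf (empirical x) a = (N : ℝ)⁻¹ * ∑ n, (Set.Iic a).indicator 1 (x n) := by
  have := isProbabilityMeasure_empirical hN x
  rw [cdf_eq_real, ← integral_indicator_one measurableSet_Iic, integral_empirical]

lemma cdf_weightedEmpirical (hN : 1 ≤ N) (c : ℝ) (x : Fin N → ℝ) (a : ℝ) :
    cdf (weightedEmpirical c x) a = ∑ n, weight c x n * (Set.Iic a).indicator 1 (x n) := by
  have := isProbabilityMeasure_weightedEmpirical hN c x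
  rw [cdf_eq_real, ← integral_indicator_one measurableSet_Iic, integral_weightedEmpirical]

lemma bayesUpdate_empirical (hN : 1 ≤ N) {c : ℝ} (hc : 0 ≤ c) (x : Fin N → ℝ) :
    bayesUpdate c (empirical x) = weightedEmpirical c x := by
  have := isProbabilityMeasure_empirical hN x
  have := isProbabilityMeasure_bayesUpdate hc (empirical x)
  have := isProbabilityMeasure_weightedEmpirical hN c x
  refine Measure.eq_of_cdf _ _ (StieltjesFunction.ext fun a => ?_)
  rw [cdf_weightedEmpirical hN, cdf_eq_real, ← integral_indicator_one measurableSet_Iic,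
    integral_bayesUpdate hc, integral_empirical, integral_empirical,
    mul_div_mul_left _ _ (by positivity), Finset.sum_div]
  exact Finset.sum_congr rfl fun n _ => by rw [weight, div_mul_eq_mul_div]

end

/-! ### Quantile functions -/

lemma bddBelow_le_cdf (μ : Measure ℝ) {u : ℝ} (hu : 0 < u) : BddBelow {x : ℝ | u ≤ cdf μ x} := by
  obtain ⟨y, hy⟩ := ((tendsto_cdf_atBot μ).eventually (gt_mem_nhds hu)).exists
  refine ⟨y, fun x hx => ?_⟩
  by_contra! h
  exact absurd ((le_trans hx (monotone_cdf μ h.le)).trans_lt hy) (lt_irrefl _)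

lemma quantile_le_iff (μ : Measure ℝ) {u : ℝ} (hu : 0 < u)
    (hne : ∃ y, u ≤ cdf μ y) (x : ℝ) : quantile μ u ≤ x ↔ u ≤ cdf μ x := by
  have hbdd := bddBelow_le_cdf μ hu
  refine ⟨fun h => ?_, fun h => csInf_le hbdd h⟩
  have hr : ∀ y, x < y → u ≤ cdf μ y := fun y hy => by
    obtain ⟨z, hz, hzy⟩ := exists_lt_of_csInf_lt hne (h.trans_lt hy)
    exact le_trans hz (monotone_cdf μ hzy.le)
  have hc : Filter.Tendsto (cdf μ) (nhdsWithin x (Set.Ioi x)) (nhds (cdf μ x)) :=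
    ((cdf μ).right_continuous x).mono_left (nhdsWithin_mono _ Set.Ioi_subset_Ici_self)
  exact ge_of_tendsto hc (eventually_nhdsWithin_of_forall hr)

lemma exists_le_cdf (μ : Measure ℝ) {u : ℝ} (hu : u < 1) : ∃ y, u ≤ cdf μ y := by
  obtain ⟨y, hy⟩ := ((tendsto_cdf_atTop μ).eventually (lt_mem_nhds hu)).exists
  exact ⟨y, hy.le⟩

/-- Joint measurability of the quantile function in the law and the level. For levels outside
`(0, 1]`, and for the level `1` of a law with unbounded support, the quantile is the junk value
`0`; this is why the set of levels is cut in two. -/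
lemma measurable_quantile {α : Type*} [MeasurableSpace α] {κ : α → Measure ℝ}
    (hκ : ∀ x, Measurable fun a => cdf (κ a) x) {u : α → ℝ} (hu : Measurable u) :
    Measurable fun a => quantile (κ a) (u a) := by
  refine measurable_of_Iic fun x => ?_
  set E := {a | 0 < u a} ∩ ⋃ n : ℕ, {a | u a ≤ cdf (κ a) n} with hE
  have hEm : MeasurableSet E := (measurableSet_lt measurable_const hu).inter
    (MeasurableSet.iUnion fun n => measurableSet_le hu (hκ n))
  have hset : (fun a => quantile (κ a) (u a)) ⁻¹' Set.Iic x =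
      (E ∩ {a | u a ≤ cdf (κ a) x}) ∪ (Eᶜ ∩ {_a | 0 ≤ x}) := by
    ext a
    by_cases ha : a ∈ E
    · obtain ⟨h1, h2⟩ := ha
      obtain ⟨n, hn⟩ := Set.mem_iUnion.1 h2
      have := quantile_le_iff (κ a) h1 ⟨n, hn⟩ x
      have haE : a ∈ E := ⟨h1, h2⟩
      simp [haE, this]
    · have h0 : quantile (κ a) (u a) = 0 := by
        unfold quantile
        by_cases h1 : 0 < u a
        · have : {x : ℝ | u a ≤ cdf (κ a) x} = ∅ := by
            ext y
            simp only [Set.mem_ofPred_eq, Set.mem_empty_iff_false, iff_false]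
            intro hy
            obtain ⟨n, hn⟩ := exists_nat_ge y
            exact ha ⟨h1, Set.mem_iUnion.2 ⟨n, hy.trans (monotone_cdf _ hn)⟩⟩
          rw [this, Real.sInf_empty]
        · have : {x : ℝ | u a ≤ cdf (κ a) x} = Set.univ := by
            ext y
            simpa using (not_lt.1 h1).trans (cdf_nonneg _ _)
          rw [this, Real.sInf_univ]
      simp [ha, h0]
  rw [hset]
  exact (hEm.inter (measurableSet_le hu (hκ x))).union (hEm.compl.inter (MeasurableSet.const _))

instance : IsProbabilityMeasure (volume.restrict (Set.Ioo (0 : ℝ) 1)) :=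
  ⟨by simp⟩

lemma uniformSquare_eq_prod :
    uniformSquare =
      (volume.restrict (Set.Ioo (0 : ℝ) 1)).prod (volume.restrict (Set.Ioo (0 : ℝ) 1)) := by
  rw [Measure.prod_restrict]
  rfl

instance : IsProbabilityMeasure uniformSquare := by
  rw [uniformSquare_eq_prod]
  infer_instance

/-- Inverse transform sampling. -/
lemma map_quantile (μ : Measure ℝ) [IsProbabilityMeasure μ] :
    (volume.restrict (Set.Ioo (0 : ℝ) 1)).map (quantile μ) = μ := by
  have hm : Measurable (quantile μ) :=
    measurable_quantile (κ := fun _ : ℝ => μ) (fun x => measurable_const) measurable_id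
  have := Measure.isProbabilityMeasure_map (μ := volume.restrict (Set.Ioo (0 : ℝ) 1))
    hm.aemeasurable
  refine Measure.ext_of_Iic _ _ fun x => ?_
  rw [Measure.map_apply hm measurableSet_Iic, ← ofReal_cdf μ x,
    Measure.restrict_apply (hm measurableSet_Iic)]
  have hle := cdf_le_one μ x
  have h0 := cdf_nonneg μ x
  have hset : (quantile μ ⁻¹' Set.Iic x ∩ Set.Ioo 0 1 : Set ℝ) =ᵐ[volume]
      (Set.Ioc 0 (cdf μ x) : Set ℝ) := by
    have h1 : quantile μ ⁻¹' Set.Iic x ∩ Set.Ioo 0 1 = Set.Ioc 0 (cdf μ x) ∩ {1}ᶜ := by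
      ext u
      simp only [Set.mem_inter_iff, Set.mem_preimage, Set.mem_Iic, Set.mem_Ioo, Set.mem_Ioc,
        Set.mem_compl_iff, Set.mem_singleton_iff]
      constructor
      · rintro ⟨h, hu0, hu1⟩
        exact ⟨⟨hu0, (quantile_le_iff μ hu0 (exists_le_cdf μ hu1) x).1 h⟩, hu1.ne⟩
      · rintro ⟨⟨hu0, h⟩, hne⟩
        have hu1 : u < 1 := lt_of_le_of_ne (h.trans hle) hne
        exact ⟨(quantile_le_iff μ hu0 (exists_le_cdf μ hu1) x).2 h, hu0, hu1⟩
    rw [h1]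
    exact inter_ae_eq_left_of_ae_eq_univ (by
      rw [ae_eq_univ]
      simp)
  rw [measure_congr hset, Real.volume_Ioc, sub_zero]

/-- Sampling from `μ` and then from the kernel, with two independent uniform variables. -/
lemma map_quantile_quantile (μ : Measure ℝ) [IsProbabilityMeasure μ] (κ : Kernel ℝ ℝ)
    [IsMarkovKernel κ] :
    uniformSquare.map (fun u => quantile (κ (quantile μ u.1)) u.2) = μ.bind κ := by
  have hμ : Measurable (quantile μ) :=
    measurable_quantile (κ := fun _ : ℝ => μ) (fun x => measurable_const) measurable_id
  have hcdf : ∀ x, Measurable fun z => cdf (κ z) x := fun x => by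
    simp_rw [cdf_eq_real]
    exact (κ.measurable_coe measurableSet_Iic).ennreal_toReal
  have hm : Measurable fun u : ℝ × ℝ => quantile (κ (quantile μ u.1)) u.2 :=
    measurable_quantile (κ := fun u : ℝ × ℝ => κ (quantile μ u.1))
      (fun x => (hcdf x).comp (hμ.comp measurable_fst)) measurable_snd
  ext A hA
  rw [Measure.map_apply hm hA, uniformSquare_eq_prod, Measure.prod_apply (hm hA),
    Measure.bind_apply hA κ.aemeasurable]
  conv_rhs => rw [← map_quantile μ]
  rw [lintegral_map (κ.measurable_coe hA) hμ]
  refine lintegral_congr fun v => ?_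
  have hq : Measurable (quantile (κ (quantile μ v))) :=
    measurable_quantile (κ := fun _ : ℝ => κ (quantile μ v)) (fun x => measurable_const)
      measurable_id
  conv_rhs => rw [← map_quantile (κ (quantile μ v)), Measure.map_apply hq hA]
  rfl

/-! ### Empirical distribution functions -/

lemma hoeffding_pi {α : Type*} [MeasurableSpace α] (ν : Measure α) [IsProbabilityMeasure ν]
    {N : ℕ} (hN : 1 ≤ N) {f : α → ℝ} (hf : Measurable f) (h01 : ∀ x, f x ∈ Set.Icc (0 : ℝ) 1)
    {ε : ℝ} (hε : 0 ≤ ε) :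
    (Measure.pi fun _ : Fin N => ν) {u | ε ≤ |(N : ℝ)⁻¹ * ∑ n, f (u n) - ∫ x, f x ∂ν|} ≤
      ENNReal.ofReal (2 * Real.exp (-2 * N * ε ^ 2)) := by
  have hN' : (0 : ℝ) < N := by exact_mod_cast hN
  have hint : ∀ n : Fin N, ∫ u, f (u n) ∂(Measure.pi fun _ : Fin N => ν) = ∫ x, f x ∂ν := by
    intro n
    have h := (measurePreserving_eval (fun _ : Fin N => ν) n).map_eq
    conv_rhs => rw [← h]
    rw [integral_map (measurable_pi_apply n).aemeasurable hf.aestronglyMeasurable]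
  have hsub : ∀ n : Fin N, HasSubgaussianMGF (fun u : Fin N → α => f (u n) - ∫ x, f x ∂ν)
      ((‖(1 : ℝ) - 0‖₊ / 2) ^ 2) (Measure.pi fun _ : Fin N => ν) := by
    intro n
    rw [← hint n]
    exact hasSubgaussianMGF_of_mem_Icc (hf.comp (measurable_pi_apply n)).aemeasurable
      (Filter.Eventually.of_forall fun u => h01 _)
  have hind : iIndepFun (fun (n : Fin N) (u : Fin N → α) => f (u n) - ∫ x, f x ∂ν)
      (Measure.pi fun _ : Fin N => ν) :=
    iIndepFun_pi (X := fun _ x => f x - ∫ x, f x ∂ν) fun _ => (hf.sub_const _).aemeasurable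
  have hind' : iIndepFun (fun (n : Fin N) (u : Fin N → α) => -(f (u n) - ∫ x, f x ∂ν))
      (Measure.pi fun _ : Fin N => ν) :=
    iIndepFun_pi (X := fun _ x => -(f x - ∫ x, f x ∂ν)) fun _ =>
      (hf.sub_const _).neg.aemeasurable
  have hexp : -((N : ℝ) * ε) ^ 2 /
      (2 * ((∑ _n : Fin N, (‖(1 : ℝ) - 0‖₊ / 2) ^ 2 : NNReal) : ℝ)) = -2 * N * ε ^ 2 := by
    simp only [sub_zero, nnnorm_one, Finset.sum_const, Finset.card_univ, Fintype.card_fin,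
      nsmul_eq_mul]
    push_cast
    field_simp
  have h1 := HasSubgaussianMGF.measure_sum_ge_le_of_iIndepFun hind (s := Finset.univ)
    (fun n _ => hsub n) (ε := N * ε) (by positivity)
  have h2 := HasSubgaussianMGF.measure_sum_ge_le_of_iIndepFun hind' (s := Finset.univ)
    (fun n _ => (hsub n).neg) (ε := N * ε) (by positivity)
  rw [hexp] at h1 h2
  have hincl : {u : Fin N → α | ε ≤ |(N : ℝ)⁻¹ * ∑ n, f (u n) - ∫ x, f x ∂ν|} ⊆
      {u | N * ε ≤ ∑ n, (f (u n) - ∫ x, f x ∂ν)} ∪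
        {u | N * ε ≤ ∑ n, -(f (u n) - ∫ x, f x ∂ν)} := by
    intro u hu
    have e : (N : ℝ)⁻¹ * ∑ n, f (u n) - ∫ x, f x ∂ν =
        (N : ℝ)⁻¹ * ∑ n, (f (u n) - ∫ x, f x ∂ν) := by
      rw [Finset.sum_sub_distrib]
      simp
      field_simp
    simp only [Set.mem_ofPred_eq] at hu
    rw [e, abs_mul, abs_of_pos (inv_pos.2 hN'), ← div_eq_inv_mul, le_div_iff₀ hN',
      mul_comm] at hu
    simp only [Set.mem_union, Set.mem_ofPred_eq, Finset.sum_neg_distrib]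
    exact le_abs.1 hu
  refine (measure_mono hincl).trans ((measure_union_le _ _).trans ?_)
  rw [two_mul, ENNReal.ofReal_add (Real.exp_pos _).le (Real.exp_pos _).le]
  refine add_le_add ?_ ?_
  · rw [← ofReal_measureReal]
    exact ENNReal.ofReal_le_ofReal h1
  · rw [← ofReal_measureReal]
    exact ENNReal.ofReal_le_ofReal h2

lemma measureReal_Iio_quantile_le (ξ : Measure ℝ) [IsProbabilityMeasure ξ] {v : ℝ} (h0 : 0 < v)
    (h1 : v < 1) : ξ.real (Set.Iio (quantile ξ v)) ≤ v := by
  have h := (cdf ξ).measure_Iio (tendsto_cdf_atBot ξ) (quantile ξ v)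
  rw [measure_cdf, sub_zero] at h
  rw [Measure.real, h]
  refine ENNReal.toReal_le_of_le_ofReal h0.le (ENNReal.ofReal_le_ofReal ?_)
  refine le_of_tendsto ((monotone_cdf ξ).tendsto_leftLim _)
    (eventually_nhdsWithin_of_forall fun y hy => ?_)
  by_contra! hlt
  exact absurd ((quantile_le_iff ξ h0 (exists_le_cdf ξ h1) y).2 hlt.le) (not_le.2 hy)

/-- Comparison of distribution functions at the quantiles of `ξ` of levels `j / N` is enough, up to
`1 / N`. Open half-lines are needed because `ξ` may have atoms. The level `0`, whose quantile is a
junk value, is included only to index the levels by `Finset.range N`. -/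
lemma kolmogorovLE_of_grid {μ ξ : Measure ℝ} [IsProbabilityMeasure μ] [IsProbabilityMeasure ξ]
    {N : ℕ} (hN : 1 ≤ N) {ε : ℝ} (hε : 0 ≤ ε)
    (h : ∀ j ∈ Finset.range N,
      |μ.real (Set.Iic (quantile ξ (j / N))) - ξ.real (Set.Iic (quantile ξ (j / N)))| ≤ ε ∧
      |μ.real (Set.Iio (quantile ξ (j / N))) - ξ.real (Set.Iio (quantile ξ (j / N)))| ≤ ε) :
    KolmogorovLE μ ξ (ε + 1 / N) := by
  intro a
  have hN' : (0 : ℝ) < N := by exact_mod_cast hN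
  have hF0 := cdf_nonneg ξ a
  have hF1 := cdf_le_one ξ a
  have hμ0 := cdf_nonneg μ a
  have hμ1 := cdf_le_one μ a
  have hlev : ∀ j : ℕ, 0 < j → j < N → (0 : ℝ) < j / N ∧ (j : ℝ) / N < 1 := fun j h0 h1 =>
    ⟨by positivity, by
      rw [div_lt_one hN']
      exact_mod_cast h1⟩
  rw [abs_le]
  constructor
  · -- the lower bound, from the largest level `j / N` below `cdf ξ a`
    rcases hF0.eq_or_lt with hF | hF
    · rw [← hF]
      have : (0 : ℝ) < 1 / N := by positivity
      linarith
    obtain ⟨j, hj1, hj2⟩ : ∃ j : ℕ, (j : ℝ) < cdf ξ a * N ∧ cdf ξ a * N ≤ j + 1 := by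
      have hpos : 0 < ⌈cdf ξ a * N⌉₊ := Nat.ceil_pos.2 (by positivity)
      refine ⟨⌈cdf ξ a * N⌉₊ - 1, ?_, ?_⟩
      · exact Nat.lt_ceil.1 (by lia)
      · refine (Nat.le_ceil _).trans ?_
        exact_mod_cast (by lia : ⌈cdf ξ a * N⌉₊ ≤ ⌈cdf ξ a * N⌉₊ - 1 + 1)
    have hF' : cdf ξ a ≤ j / N + 1 / N := by
      rw [← add_div, le_div_iff₀ hN']
      exact hj2
    rcases Nat.eq_zero_or_pos j with rfl | hj0
    · simp only [Nat.cast_zero, zero_div, zero_add] at hF'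
      linarith
    have hjN : j < N := by
      have : (j : ℝ) < N := hj1.trans_le (by nlinarith)
      exact_mod_cast this
    obtain ⟨hl0, hl1⟩ := hlev j hj0 hjN
    have hle : quantile ξ (j / N) ≤ a := (quantile_le_iff ξ hl0 (exists_le_cdf ξ hl1) a).2 (by
      rw [div_le_iff₀ hN']
      exact hj1.le)
    have h1 := (abs_le.1 (h j (Finset.mem_range.2 hjN)).1).1
    have h2 : (j : ℝ) / N ≤ cdf ξ (quantile ξ (j / N)) :=
      (quantile_le_iff ξ hl0 (exists_le_cdf ξ hl1) _).1 le_rfl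
    have h3 := monotone_cdf μ hle
    rw [← cdf_eq_real, ← cdf_eq_real] at h1
    linarith
  · -- the upper bound, from the smallest level `j / N` above `cdf ξ a`
    obtain ⟨j, hj1, hj2⟩ : ∃ j : ℕ, cdf ξ a * N < j ∧ (j : ℝ) ≤ cdf ξ a * N + 1 := by
      refine ⟨⌊cdf ξ a * N⌋₊ + 1, ?_, ?_⟩
      · push_cast
        exact Nat.lt_floor_add_one _
      · push_cast
        have := Nat.floor_le (by positivity : 0 ≤ cdf ξ a * N)
        linarith
    have hF' : (j : ℝ) / N ≤ cdf ξ a + 1 / N := by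
      rw [div_le_iff₀ hN', add_mul, div_mul_cancel₀ _ hN'.ne']
      exact hj2
    rcases lt_or_ge j N with hjN | hjN
    · have hj0 : 0 < j := by
        have : (0 : ℝ) < j := lt_of_le_of_lt (by positivity) hj1
        exact_mod_cast this
      obtain ⟨hl0, hl1⟩ := hlev j hj0 hjN
      have hlt : a < quantile ξ (j / N) := by
        rw [← not_le, quantile_le_iff ξ hl0 (exists_le_cdf ξ hl1), not_le, lt_div_iff₀ hN']
        exact hj1
      have h1 := (abs_le.1 (h j (Finset.mem_range.2 hjN)).2).2
      have h2 := measureReal_Iio_quantile_le ξ hl0 hl1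
      have h3 : cdf μ a ≤ μ.real (Set.Iio (quantile ξ (j / N))) := by
        rw [cdf_eq_real]
        exact measureReal_mono (Set.Iic_subset_Iio.2 hlt)
      linarith
    · have : (1 : ℝ) ≤ j / N := by
        rw [le_div_iff₀ hN', one_mul]
        exact_mod_cast hjN
      linarith

/-- A Dvoretzky–Kiefer–Wolfowitz inequality, with an additional factor `N` in front of the
exponential. -/
lemma dvoretzky_kiefer_wolfowitz {α : Type*} [MeasurableSpace α] (ν : Measure α)
    [IsProbabilityMeasure ν] {N : ℕ} (hN : 1 ≤ N) {φ : α → ℝ} (hφ : Measurable φ) {ε : ℝ}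
    (hε : 0 ≤ ε) :
    (Measure.pi fun _ : Fin N => ν)
        {u | ¬ KolmogorovLE (empirical fun n => φ (u n)) (ν.map φ) (ε + 1 / N)} ≤
      ENNReal.ofReal (4 * N * Real.exp (-2 * N * ε ^ 2)) := by
  have := Measure.isProbabilityMeasure_map (μ := ν) hφ.aemeasurable
  set E : Set ℝ → Set (Fin N → α) := fun S =>
    {u | ε ≤ |(N : ℝ)⁻¹ * ∑ n, S.indicator 1 (φ (u n)) - ∫ x, S.indicator 1 (φ x) ∂ν|} with hE
  have hprob : ∀ S, MeasurableSet S → (Measure.pi fun _ : Fin N => ν) (E S) ≤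
      ENNReal.ofReal (2 * Real.exp (-2 * N * ε ^ 2)) := fun S hS =>
    hoeffding_pi ν hN (f := fun x => S.indicator 1 (φ x))
      ((measurable_one.indicator hS).comp hφ)
      (fun x => by by_cases hx : φ x ∈ S <;> simp [hx]) hε
  have hmem : ∀ S, MeasurableSet S → ∀ u, u ∉ E S →
      |(empirical fun n => φ (u n)).real S - (ν.map φ).real S| ≤ ε := by
    intro S hS u hu
    rw [← integral_indicator_one hS, ← integral_indicator_one hS, integral_empirical,
      integral_map hφ.aemeasurable (measurable_one.indicator hS).aestronglyMeasurable]
    exact (not_le.1 hu).le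
  set q := fun j : ℕ => quantile (ν.map φ) (j / N)
  have hincl : {u : Fin N → α |
      ¬ KolmogorovLE (empirical fun n => φ (u n)) (ν.map φ) (ε + 1 / N)} ⊆
      ⋃ j ∈ Finset.range N, (E (Set.Iic (q j)) ∪ E (Set.Iio (q j))) := by
    intro u hu
    by_contra hcon
    simp only [Set.mem_iUnion, Set.mem_union, not_exists, not_or] at hcon
    have := isProbabilityMeasure_empirical hN fun n => φ (u n)
    exact hu (kolmogorovLE_of_grid hN hε fun j hj =>
      ⟨hmem _ measurableSet_Iic u (hcon j hj).1, hmem _ measurableSet_Iio u (hcon j hj).2⟩)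
  refine (measure_mono hincl).trans ((measure_biUnion_finset_le _ _).trans ?_)
  calc ∑ j ∈ Finset.range N,
        (Measure.pi fun _ : Fin N => ν) (E (Set.Iic (q j)) ∪ E (Set.Iio (q j)))
      ≤ ∑ _j ∈ Finset.range N, ENNReal.ofReal (4 * Real.exp (-2 * N * ε ^ 2)) := by
        refine Finset.sum_le_sum fun j _ => (measure_union_le _ _).trans ?_
        refine (add_le_add (hprob _ measurableSet_Iic) (hprob _ measurableSet_Iio)).trans ?_
        rw [← ENNReal.ofReal_add (by positivity) (by positivity)]
        exact ENNReal.ofReal_le_ofReal (by linarith)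
    _ = ENNReal.ofReal (4 * N * Real.exp (-2 * N * ε ^ 2)) := by
        rw [Finset.sum_const, Finset.card_range, nsmul_eq_mul, ← ENNReal.ofReal_natCast,
          ← ENNReal.ofReal_mul (by positivity)]
        congr 1
        ring

lemma kolmogorovLE_of_rat {μ ν : Measure ℝ} {d : ℝ} (h : ∀ r : ℚ, |cdf μ r - cdf ν r| ≤ d) :
    KolmogorovLE μ ν d := by
  intro x
  have hc : ∀ π : Measure ℝ,
      Filter.Tendsto (cdf π) (nhdsWithin x (Set.Ioi x)) (nhds (cdf π x)) := fun π =>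
    ((cdf π).right_continuous x).mono_left (nhdsWithin_mono _ Set.Ioi_subset_Ici_self)
  refine le_of_tendsto_of_frequently ((hc μ).sub (hc ν)).abs fun hev => ?_
  obtain ⟨b, hb, hsub⟩ := mem_nhdsGT_iff_exists_Ioo_subset.1 hev
  obtain ⟨r, hr1, hr2⟩ := exists_rat_btwn (show x < b from hb)
  exact hsub ⟨hr1, hr2⟩ (h r)

/-! ### Local errors of the particle filter -/

section
variable {N : ℕ} {ρ σ c : ℝ}

/-- The particle produced by one resampling and one mutation from the particles `x`, with the
uniform variables `v`. -/
def newParticle (ρ σ c : ℝ) (x : Fin N → ℝ) (v : ℝ × ℝ) : ℝ :=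
  quantile (transition ρ σ (quantile (weightedEmpirical c x) v.1)) v.2

lemma measurable_cdf_transition (ρ σ a : ℝ) : Measurable fun z => cdf (transition ρ σ z) a := by
  simp_rw [cdf_eq_real]
  exact ((transition ρ σ).measurable_coe measurableSet_Iic).ennreal_toReal

lemma measurable_weight (c : ℝ) (n : Fin N) : Measurable fun x : Fin N → ℝ => weight c x n := by
  unfold weight
  fun_prop

lemma measurable_cdf_weightedEmpirical (hN : 1 ≤ N) (c a : ℝ) :
    Measurable fun x : Fin N → ℝ => cdf (weightedEmpirical c x) a := by
  simp_rw [cdf_weightedEmpirical hN]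
  refine Finset.measurable_sum _ fun n _ => (measurable_weight c n).mul ?_
  exact (measurable_one.indicator measurableSet_Iic).comp (measurable_pi_apply n)

lemma measurable_cdf_empirical (hN : 1 ≤ N) (a : ℝ) :
    Measurable fun x : Fin N → ℝ => cdf (empirical x) a := by
  simp_rw [cdf_empirical hN]
  refine (Finset.measurable_sum _ fun n _ => ?_).const_mul _
  exact (measurable_one.indicator measurableSet_Iic).comp (measurable_pi_apply n)

lemma measurable_newParticle (hN : 1 ≤ N) (ρ σ c : ℝ) :
    Measurable fun p : (Fin N → ℝ) × (ℝ × ℝ) => newParticle ρ σ c p.1 p.2 := by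
  have h1 : Measurable fun p : (Fin N → ℝ) × (ℝ × ℝ) =>
      quantile (weightedEmpirical c p.1) p.2.1 :=
    measurable_quantile (κ := fun p : (Fin N → ℝ) × (ℝ × ℝ) => weightedEmpirical c p.1)
      (fun a => (measurable_cdf_weightedEmpirical hN c a).comp measurable_fst)
      (measurable_fst.comp measurable_snd)
  exact measurable_quantile
    (κ := fun p : (Fin N → ℝ) × (ℝ × ℝ) =>
      transition ρ σ (quantile (weightedEmpirical c p.1) p.2.1))
    (fun a => (measurable_cdf_transition ρ σ a).comp h1) (measurable_snd.comp measurable_snd)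

lemma map_newParticle (hN : 1 ≤ N) (ρ σ : ℝ) (hc : 0 ≤ c) (x : Fin N → ℝ) :
    uniformSquare.map (newParticle ρ σ c x) = predictiveStep ρ σ c (empirical x) := by
  have := isProbabilityMeasure_weightedEmpirical hN c x
  rw [predictiveStep, bayesUpdate_empirical hN hc]
  exact map_quantile_quantile (weightedEmpirical c x) (transition ρ σ)

lemma measurable_cdf_predictiveStep_empirical (hN : 1 ≤ N) (ρ σ : ℝ) (hc : 0 ≤ c) (a : ℝ) :
    Measurable fun x : Fin N → ℝ => cdf (predictiveStep ρ σ c (empirical x)) a := by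
  have e : ∀ x : Fin N → ℝ, cdf (predictiveStep ρ σ c (empirical x)) a =
      ((N : ℝ)⁻¹ * ∑ n, potential c (x n) * cdf (transition ρ σ (x n)) a) /
        ((N : ℝ)⁻¹ * ∑ n, potential c (x n)) := fun x => by
    have := isProbabilityMeasure_empirical hN x
    rw [cdf_predictiveStep ρ σ hc, integral_empirical, integral_empirical]
  simp_rw [e]
  have h1 : ∀ n : Fin N, Measurable fun x : Fin N → ℝ => potential c (x n) := fun n =>
    (measurable_potential c).comp (measurable_pi_apply n)
  have h2 : ∀ n : Fin N, Measurable fun x : Fin N → ℝ => cdf (transition ρ σ (x n)) a :=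
    fun n => (measurable_cdf_transition ρ σ a).comp (measurable_pi_apply n)
  exact ((Finset.measurable_sum _ fun n _ => (h1 n).mul (h2 n)).const_mul _).div
    ((Finset.measurable_sum _ fun n _ => h1 n).const_mul _)

/-- The local error at one time step, given the past particles: they are independent of the
variables that drive the step. -/
lemma measure_not_kolmogorovLE_newParticle {Ω : Type*} [MeasurableSpace Ω] (P : Measure Ω)
    [IsProbabilityMeasure P] (hN : 1 ≤ N) (ρ σ : ℝ) (hc : 0 ≤ c) {X : Ω → Fin N → ℝ}
    {V : Ω → Fin N → ℝ × ℝ} (hX : Measurable X) (hV : Measurable V) (hXV : IndepFun X V P)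
    (hlaw : P.map V = Measure.pi fun _ => uniformSquare) {ε : ℝ} (hε : 0 ≤ ε) :
    P {ω | ¬ KolmogorovLE (empirical fun n => newParticle ρ σ c (X ω) (V ω n))
        (predictiveStep ρ σ c (empirical (X ω))) (ε + 1 / N)} ≤
      ENNReal.ofReal (4 * N * Real.exp (-2 * N * ε ^ 2)) := by
  have hnew := measurable_newParticle hN ρ σ c
  set B : Set ((Fin N → ℝ) × (Fin N → ℝ × ℝ)) :=
    {p | ¬ KolmogorovLE (empirical fun n => newParticle ρ σ c p.1 (p.2 n))
      (predictiveStep ρ σ c (empirical p.1)) (ε + 1 / N)} with hBdef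
  have hY : Measurable fun (p : (Fin N → ℝ) × (Fin N → ℝ × ℝ)) (n : Fin N) =>
      newParticle ρ σ c p.1 (p.2 n) := measurable_pi_lambda _ fun n =>
    hnew.comp (g := fun p : (Fin N → ℝ) × (ℝ × ℝ) => newParticle ρ σ c p.1 p.2)
      (f := fun p : (Fin N → ℝ) × (Fin N → ℝ × ℝ) => (p.1, p.2 n))
      (measurable_fst.prodMk ((measurable_pi_apply n).comp measurable_snd))
  have hB : MeasurableSet B := by
    have e : B = (⋂ r : ℚ, {p : (Fin N → ℝ) × (Fin N → ℝ × ℝ) |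
        |cdf (empirical fun n => newParticle ρ σ c p.1 (p.2 n)) r -
          cdf (predictiveStep ρ σ c (empirical p.1)) r| ≤ ε + 1 / N})ᶜ := by
      ext p
      simp only [hBdef, Set.mem_ofPred_eq, Set.mem_compl_iff, Set.mem_iInter]
      exact not_congr ⟨fun h r => h r, kolmogorovLE_of_rat⟩
    rw [e]
    refine (MeasurableSet.iInter fun r => ?_).compl
    have h1 := (measurable_cdf_empirical hN r).comp hY
    have h2 := (measurable_cdf_predictiveStep_empirical hN ρ σ hc r).comp
      (show Measurable fun p : (Fin N → ℝ) × (Fin N → ℝ × ℝ) => p.1 from measurable_fst)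
    exact measurableSet_le (h1.sub h2).abs measurable_const
  have hmap := (indepFun_iff_map_prod_eq_prod_map_map hX.aemeasurable hV.aemeasurable).1 hXV
  have h1 : P {ω | ¬ KolmogorovLE (empirical fun n => newParticle ρ σ c (X ω) (V ω n))
        (predictiveStep ρ σ c (empirical (X ω))) (ε + 1 / N)} =
      P.map (fun ω => (X ω, V ω)) B := by
    rw [Measure.map_apply (hX.prodMk hV) hB]
    rfl
  have := Measure.isProbabilityMeasure_map (μ := P) hX.aemeasurable
  rw [h1, hmap, hlaw, Measure.prod_apply hB]
  calc ∫⁻ x, (Measure.pi fun _ => uniformSquare) (Prod.mk x ⁻¹' B) ∂(P.map X)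
      ≤ ∫⁻ _x, ENNReal.ofReal (4 * N * Real.exp (-2 * N * ε ^ 2)) ∂(P.map X) := by
        refine lintegral_mono fun x => ?_
        have := dvoretzky_kiefer_wolfowitz uniformSquare hN
          (φ := newParticle ρ σ c x) (hnew.of_uncurry_left (f := newParticle ρ σ c)) hε
        rw [map_newParticle hN ρ σ hc] at this
        exact this
    _ = _ := by simp

lemma measurable_particles (hN : 1 ≤ N) (ρ σ c : ℝ) (η : Measure ℝ) (k : ℕ) :
    Measurable fun u : ℕ → Fin N → ℝ × ℝ => particles ρ σ c η u k := by
  have hu : ∀ k n, Measurable fun u : ℕ → Fin N → ℝ × ℝ => u k n := fun k n => by fun_prop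
  induction k with
  | zero =>
    refine measurable_pi_lambda _ fun n => ?_
    exact measurable_quantile (κ := fun _ : ℕ → Fin N → ℝ × ℝ => η)
      (fun x => measurable_const) (measurable_fst.comp (hu 0 n))
  | succ k ih =>
    refine measurable_pi_lambda _ fun n => ?_
    have h := (measurable_newParticle hN ρ σ c).comp (ih.prodMk (hu (k + 1) n))
    exact h

/-- The particles at time `k` depend on the driving variables up to time `k` only. -/
lemma particles_congr (ρ σ c : ℝ) (η : Measure ℝ) {u v : ℕ → Fin N → ℝ × ℝ} {k : ℕ}
    (h : ∀ j ≤ k, u j = v j) : particles ρ σ c η u k = particles ρ σ c η v k := by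
  induction k with
  | zero =>
    ext n
    simp only [particles, h 0 le_rfl]
  | succ k ih =>
    ext n
    simp only [particles, h (k + 1) le_rfl, ih fun j hj => h j (hj.trans k.le_succ)]

section
variable {Ω : Type*} [MeasurableSpace Ω] {P : Measure Ω} {U : ℕ → Fin N → Ω → ℝ × ℝ}

lemma indepFun_particles_driving (hN : 1 ≤ N) (ρ σ c : ℝ) (η : Measure ℝ)
    (hU : ∀ k n, Measurable (U k n))
    (hind : iIndepFun (fun i : ℕ × Fin N => U i.1 i.2) P) (k : ℕ) :
    IndepFun (fun ω => particles ρ σ c η (fun j n => U j n ω) k)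
      (fun ω n => U (k + 1) n ω) P := by
  set S : Finset (ℕ × Fin N) := Finset.range (k + 1) ×ˢ Finset.univ with hS
  set S' : Finset (ℕ × Fin N) := {k + 1} ×ˢ Finset.univ with hS'
  have hdisj : Disjoint S S' := by
    rw [Finset.disjoint_left]
    rintro ⟨j, n⟩ h1 h2
    simp only [hS, hS', Finset.mem_product, Finset.mem_range, Finset.mem_singleton,
      Finset.mem_univ, and_true] at h1 h2
    lia
  have h := hind.indepFun_finset S S' hdisj fun i => hU i.1 i.2
  have hmemS : ∀ j n, j ≤ k → (j, n) ∈ S := fun j n hj => by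
    simp only [hS, Finset.mem_product, Finset.mem_range, Finset.mem_univ, and_true]
    lia
  have hmemS' : ∀ n, (k + 1, n) ∈ S' := fun n => by simp [hS']
  classical
  -- The variables up to time `k`, extended by `0`, give the same particles at time `k`.
  set extend : (S → ℝ × ℝ) → ℕ → Fin N → ℝ × ℝ := fun g j n =>
    if hj : (j, n) ∈ S then g ⟨(j, n), hj⟩ else 0 with hextend
  have hextend_meas : Measurable extend := by
    refine measurable_pi_lambda _ fun j => measurable_pi_lambda _ fun n => ?_
    by_cases hj : (j, n) ∈ S
    · simp only [hextend, hj, dif_pos]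
      exact measurable_pi_apply _
    · simp only [hextend, hj, dif_neg, not_false_eq_true]
      exact measurable_const
  have hcomp := h.comp ((measurable_particles hN ρ σ c η k).comp hextend_meas)
    (ψ := fun (g : S' → ℝ × ℝ) (n : Fin N) => g ⟨(k + 1, n), hmemS' n⟩)
    (measurable_pi_lambda _ fun n => measurable_pi_apply _)
  have e : (fun ω => particles ρ σ c η (fun j n => U j n ω) k) =
      ((fun u => particles ρ σ c η u k) ∘ extend) ∘ fun ω (i : S) => U i.1.1 i.1.2 ω := by
    ext1 ω
    refine particles_congr ρ σ c η fun j hj => ?_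
    ext1 n
    simp only [hextend, hmemS j n hj, dif_pos]
  rw [e]
  exact hcomp

variable [IsProbabilityMeasure P]

lemma map_driving_eq_pi (hU : ∀ k n, Measurable (U k n))
    (hlaw : ∀ k n, P.map (U k n) = uniformSquare)
    (hind : iIndepFun (fun i : ℕ × Fin N => U i.1 i.2) P) (k : ℕ) :
    P.map (fun ω n => U k n ω) = Measure.pi fun _ : Fin N => uniformSquare := by
  have h := hind.precomp (g := fun n : Fin N => (k, n)) (fun m n h => (Prod.mk.inj h).2)
  rw [(iIndepFun_iff_map_fun_eq_pi_map fun n => (hU k n).aemeasurable).1 h]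
  simp_rw [hlaw]

/-- The local errors of the particle filter. -/
lemma measure_not_kolmogorovLE_particles (hN : 1 ≤ N) (ρ σ : ℝ) (hc : 0 ≤ c) (η : Measure ℝ)
    [IsProbabilityMeasure η] (hU : ∀ k n, Measurable (U k n))
    (hlaw : ∀ k n, P.map (U k n) = uniformSquare)
    (hind : iIndepFun (fun i : ℕ × Fin N => U i.1 i.2) P) {ε : ℝ} (hε : 0 ≤ ε) :
    P {ω | ¬ KolmogorovLE (empirical (particles ρ σ c η (fun j n => U j n ω) 0)) η
        (ε + 1 / N)} ≤ ENNReal.ofReal (4 * N * Real.exp (-2 * N * ε ^ 2)) ∧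
      ∀ k, P {ω | ¬ KolmogorovLE (empirical (particles ρ σ c η (fun j n => U j n ω) (k + 1)))
          (predictiveStep ρ σ c (empirical (particles ρ σ c η (fun j n => U j n ω) k)))
          (ε + 1 / N)} ≤ ENNReal.ofReal (4 * N * Real.exp (-2 * N * ε ^ 2)) := by
  have hVm : ∀ k, Measurable fun ω n => U k n ω := fun k => measurable_pi_lambda _ (hU k)
  constructor
  · have hq : Measurable fun v : ℝ × ℝ => quantile η v.1 :=
      measurable_quantile (κ := fun _ : ℝ × ℝ => η) (fun x => measurable_const) measurable_fst
    have hmapη : uniformSquare.map (fun v : ℝ × ℝ => quantile η v.1) = η := by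
      have hη : Measurable (quantile η) :=
        measurable_quantile (κ := fun _ : ℝ => η) (fun x => measurable_const) measurable_id
      conv_rhs => rw [← map_quantile η]
      rw [uniformSquare_eq_prod]
      change Measure.map (quantile η ∘ Prod.fst) _ = _
      rw [← Measure.map_map hη measurable_fst, Measure.map_fst_prod, measure_univ, one_smul]
    have h := dvoretzky_kiefer_wolfowitz uniformSquare hN hq hε
    rw [hmapη, ← map_driving_eq_pi hU hlaw hind 0] at h
    exact (Measure.le_map_apply (hVm 0).aemeasurable _).trans h
  · intro k
    exact measure_not_kolmogorovLE_newParticle P hN ρ σ hc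
      ((measurable_particles hN ρ σ c η k).comp (measurable_pi_lambda _ hVm)) (hVm (k + 1))
      (indepFun_particles_driving hN ρ σ c η hU hind k)
      (map_driving_eq_pi hU hlaw hind (k + 1)) hε

end
end

/-! ### The rate -/

/-- For `δ ≤ 1` the rate absorbs the factor `N` of the inequality for empirical distribution
functions. Here `L = 1 + log (T / q)`, so that `exp (1 - L) = q / T`, and `x = δ ^ (-1/2)`. -/
lemma four_mul_exp_le {N L x : ℝ} (hL : 1 ≤ L) (hx : 1 ≤ x) (hN : N = L * x ^ 2) :
    4 * N * Real.exp (-2 * N * (2 * (x⁻¹ * Real.log (1 + x))) ^ 2) ≤ Real.exp (1 - L) := by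
  have hx0 : 0 < x := by linarith
  have hL0 : 0 < L := by linarith
  have hlog4 : Real.log 4 ≤ 2 := by
    rw [show (4 : ℝ) = 2 ^ 2 by norm_num, Real.log_pow]
    have := Real.log_two_lt_d9
    push_cast
    linarith
  have hl : 0.69 ≤ Real.log (1 + x) := by
    have h1 : Real.log 2 ≤ Real.log (1 + x) := Real.log_le_log (by norm_num) (by linarith)
    have := Real.log_two_gt_d9
    linarith
  have hlogx : Real.log x ≤ Real.log (1 + x) := Real.log_le_log hx0 (by linarith)
  have hlogL : Real.log L ≤ L - 1 := Real.log_le_sub_one_of_pos hL0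
  have hNlog : 4 * N = Real.exp (Real.log 4 + Real.log L + 2 * Real.log x) := by
    rw [Real.exp_add, Real.exp_add, Real.exp_log (by norm_num), Real.exp_log hL0, two_mul,
      Real.exp_add, Real.exp_log hx0, hN]
    ring
  have hexp : -2 * N * (2 * (x⁻¹ * Real.log (1 + x))) ^ 2 = -8 * L * Real.log (1 + x) ^ 2 := by
    rw [hN]
    field_simp
    ring
  rw [hexp, hNlog, ← Real.exp_add, Real.exp_le_exp]
  set l := Real.log (1 + x)
  have h1 : 0.69 * l ≤ l ^ 2 := by nlinarith
  have h2 : 2 * l ≤ 3 * l ^ 2 := by nlinarith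
  have h3 : 2 ≤ 5 * l ^ 2 := by nlinarith
  have h4 : l ^ 2 ≤ L * l ^ 2 := le_mul_of_one_le_left (sq_nonneg l) hL
  have h5 : 2 * L ≤ 5 * (L * l ^ 2) := by nlinarith
  linarith

/-- The rate is bounded below for `δ ≥ 1`, that is for `x = δ ^ (-1/2) ≤ 1`. -/
lemma half_le_inv_mul_log {x : ℝ} (hx0 : 0 < x) (hx : x ≤ 1) :
    1 / 2 ≤ x⁻¹ * Real.log (1 + x) := by
  have h1 := Real.one_sub_inv_le_log_of_pos (show 0 < 1 + x by linarith)
  have h2 : x / 2 ≤ 1 - (1 + x)⁻¹ := by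
    have : 1 - (1 + x)⁻¹ = x / (1 + x) := by
      field_simp
      ring
    rw [this]
    gcongr
    linarith
  rw [← div_eq_inv_mul, le_div_iff₀ hx0]
  linarith

end

end ToyPF

/-! ### The uniform error bound -/

theorem theorem1 (ρ σ c : ℝ) (hσ : 0 < σ) (hc : 0 < c)
    (η₁ : Measure ℝ) [IsProbabilityMeasure η₁] :
    ∃ C : ℝ, 0 < C ∧
      ∀ (N : ℕ), 1 ≤ N →
      ∀ {Ω : Type*} [MeasurableSpace Ω] (P : Measure Ω) [IsProbabilityMeasure P]
        (U : ℕ → Fin N → Ω → ℝ × ℝ),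
        (∀ k n, Measurable (U k n)) →
        (∀ k n, P.map (U k n) = ToyPF.uniformSquare) →
        iIndepFun (fun i : ℕ × Fin N => U i.1 i.2) P →
      ∀ (q : ℝ), 0 < q → q < 1 → ∀ (T : ℕ), 1 ≤ T →
        ENNReal.ofReal (1 - q) ≤
          P {ω | max
              (⨆ k : Fin T, ToyPF.kolmogorovDist
                (ToyPF.filteringEstimate ρ σ c η₁ (fun j n => U j n ω) k)
                (ToyPF.filteringDist ρ σ c η₁ k))
              (⨆ k : Fin T, ToyPF.kolmogorovDist
                (ToyPF.predictiveEstimate ρ σ c η₁ (fun j n => U j n ω) k)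
                (ToyPF.predictiveDist ρ σ c η₁ k))
            ≤ C * ToyPF.delta N T q ^ (1 / 2 : ℝ)
                * Real.log (1 + ToyPF.delta N T q ^ (-(1 / 2) : ℝ))} := by
  obtain ⟨S, ε₀, hS, hε₀, hprop⟩ := ToyPF.exists_error_propagation ρ hσ hc η₁
  refine ⟨max (4 * S) (max (4 / ε₀) 2), by positivity, ?_⟩
  set C := max (4 * S) (max (4 / ε₀) 2) with hC
  have hC1 : 4 * S ≤ C := le_max_left _ _
  have hC2 : 4 / ε₀ ≤ C := (le_max_left _ _).trans (le_max_right _ _)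
  have hC3 : 2 ≤ C := (le_max_right _ _).trans (le_max_right _ _)
  intro N hN Ω _ P _ U hU hlaw hind q hq0 hq1 T hT
  have hN' : (1 : ℝ) ≤ N := by exact_mod_cast hN
  have hT' : (1 : ℝ) ≤ T := by exact_mod_cast hT
  have hTq : 1 ≤ (T : ℝ) / q := by
    rw [le_div_iff₀ hq0]
    linarith
  set L := 1 + Real.log (T / q) with hL
  have hL1 : 1 ≤ L := le_add_of_nonneg_right (Real.log_nonneg hTq)
  have hδ : 0 < ToyPF.delta N T q := div_pos (by linarith) (by linarith)
  set x := ToyPF.delta N T q ^ (-(1 / 2) : ℝ) with hx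
  have hx0 : 0 < x := Real.rpow_pos_of_pos hδ _
  have hxinv : ToyPF.delta N T q ^ (1 / 2 : ℝ) = x⁻¹ := by
    rw [hx, Real.rpow_neg hδ.le, inv_inv]
  have hNx : (N : ℝ) = L * x ^ 2 := by
    have h1 : x ^ 2 = (ToyPF.delta N T q)⁻¹ := by
      rw [hx, ← Real.rpow_natCast, ← Real.rpow_mul hδ.le]
      norm_num
      exact Real.rpow_neg_one _
    rw [h1, ToyPF.delta, ← hL]
    field_simp
  rw [hxinv, mul_assoc]
  set r := x⁻¹ * Real.log (1 + x) with hr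
  have hr0 : 0 < r := mul_pos (inv_pos.2 hx0) (Real.log_pos (by linarith))
  set good : Set Ω := {ω | ∀ k < T,
    ToyPF.KolmogorovLE (ToyPF.empirical (ToyPF.particles ρ σ c η₁ (fun j n => U j n ω) k))
      ((ToyPF.predictiveStep ρ σ c)^[k] η₁) (C * r) ∧
    ToyPF.KolmogorovLE
      (ToyPF.bayesUpdate c
        (ToyPF.empirical (ToyPF.particles ρ σ c η₁ (fun j n => U j n ω) k)))
      (ToyPF.bayesUpdate c ((ToyPF.predictiveStep ρ σ c)^[k] η₁)) (C * r)} with hgood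
  suffices h : ENNReal.ofReal (1 - q) ≤ P good by
    refine h.trans (measure_mono fun ω hω => ?_)
    have : Nonempty (Fin T) := ⟨⟨0, hT⟩⟩
    rw [Set.mem_ofPred_eq]
    refine max_le (ciSup_le fun k => ?_) (ciSup_le fun k => ?_)
    · rw [(ToyPF.filteringDist_eq_and_predictiveDist_eq ρ σ hc.le η₁ k).1,
        ToyPF.filteringEstimate, ← ToyPF.bayesUpdate_empirical hN hc.le]
      exact (hω k k.2).2.kolmogorovDist_le
    · rw [(ToyPF.filteringDist_eq_and_predictiveDist_eq ρ σ hc.le η₁ k).2]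
      exact (hω k k.2).1.kolmogorovDist_le
  -- When the asserted bound exceeds `1` it holds trivially.
  have htriv : 1 ≤ C * r → ENNReal.ofReal (1 - q) ≤ P good := fun h => by
    have : good = Set.univ := Set.eq_univ_of_forall fun ω k _ =>
      ⟨(ToyPF.kolmogorovLE_one _ _).mono h, (ToyPF.kolmogorovLE_one _ _).mono h⟩
    rw [this, measure_univ]
    exact ENNReal.ofReal_le_one.2 (by linarith)
  rcases le_total x 1 with hx1 | hx1
  · exact htriv (by nlinarith [ToyPF.half_le_inv_mul_log hx0 hx1])
  rcases lt_or_ge ε₀ (4 * r) with hrε | hrε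
  · refine htriv ?_
    calc 1 ≤ 4 / ε₀ * r := by
          rw [div_mul_eq_mul_div, le_div_iff₀ hε₀]
          linarith
      _ ≤ C * r := by gcongr
  -- The grid error `1 / N` is of smaller order than the rate.
  have hloc : 2 * r + 1 / N ≤ 4 * r := by
    have h1 : (1 : ℝ) / N ≤ x⁻¹ := by
      rw [one_div, hNx]
      refine inv_anti₀ hx0 ?_
      nlinarith
    have h2 : 1 / 2 ≤ Real.log (1 + x) := by
      have h3 : Real.log 2 ≤ Real.log (1 + x) := Real.log_le_log (by norm_num) (by linarith)
      have := Real.log_two_gt_d9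
      linarith
    have h3 : x⁻¹ * (1 / 2) ≤ r := mul_le_mul_of_nonneg_left h2 (inv_pos.2 hx0).le
    linarith
  have hqT : 4 * N * Real.exp (-2 * N * (2 * r) ^ 2) ≤ q / T := by
    refine (ToyPF.four_mul_exp_le hL1 hx1 hNx).trans (le_of_eq ?_)
    rw [show 1 - L = -Real.log (T / q) by rw [hL]; ring, Real.exp_neg,
      Real.exp_log (by linarith), inv_div]
  obtain ⟨hbad0, hbad⟩ := ToyPF.measure_not_kolmogorovLE_particles hN ρ σ hc.le η₁ hU hlaw hind
    (ε := 2 * r) (by positivity)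
  set bad : ℕ → Set Ω := fun k => Nat.casesOn k
    {ω | ¬ ToyPF.KolmogorovLE
      (ToyPF.empirical (ToyPF.particles ρ σ c η₁ (fun j n => U j n ω) 0)) η₁ (2 * r + 1 / N)}
    (fun k => {ω | ¬ ToyPF.KolmogorovLE
      (ToyPF.empirical (ToyPF.particles ρ σ c η₁ (fun j n => U j n ω) (k + 1)))
      (ToyPF.predictiveStep ρ σ c
        (ToyPF.empirical (ToyPF.particles ρ σ c η₁ (fun j n => U j n ω) k)))
      (2 * r + 1 / N)}) with hbaddef
  have hbadle : ∀ k, P (bad k) ≤ ENNReal.ofReal (q / T) := by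
    rintro (_ | k)
    · exact hbad0.trans (ENNReal.ofReal_le_ofReal hqT)
    · exact (hbad k).trans (ENNReal.ofReal_le_ofReal hqT)
  have hunion : P (⋃ k ∈ Finset.range T, bad k) ≤ ENNReal.ofReal q := by
    refine (measure_biUnion_finset_le _ _).trans
      ((Finset.sum_le_sum fun k _ => hbadle k).trans (le_of_eq ?_))
    rw [Finset.sum_const, Finset.card_range, nsmul_eq_mul, ← ENNReal.ofReal_natCast,
      ← ENNReal.ofReal_mul (by linarith)]
    congr 1
    field_simp
  have hcover : (Set.univ : Set Ω) ⊆ good ∪ ⋃ k ∈ Finset.range T, bad k := by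
    intro ω _
    by_cases hω : ω ∈ ⋃ k ∈ Finset.range T, bad k
    · exact Or.inr hω
    left
    have hnot : ∀ k < T, ω ∉ bad k := fun k hk h =>
      hω (Set.mem_biUnion (Finset.mem_coe.2 (Finset.mem_range.2 hk)) h)
    have h := hprop
      (fun k => ToyPF.empirical (ToyPF.particles ρ σ c η₁ (fun j n => U j n ω) k)) T (4 * r)
      (fun k => ToyPF.isProbabilityMeasure_empirical hN _) hrε
      ((not_not.1 (hnot 0 hT)).mono hloc)
      (fun k hk => (not_not.1 (hnot (k + 1) hk)).mono hloc)
    have hSC : S * (4 * r) ≤ C * r := by nlinarith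
    exact fun k hk => ⟨(h k hk).1.mono hSC, (h k hk).2.mono hSC⟩
  have h1 : 1 ≤ P good + ENNReal.ofReal q := by
    calc (1 : ENNReal) = P Set.univ := measure_univ.symm
      _ ≤ P good + P (⋃ k ∈ Finset.range T, bad k) :=
        (measure_mono hcover).trans (measure_union_le _ _)
      _ ≤ _ := by gcongr
  rw [ENNReal.ofReal_sub _ hq0.le, ENNReal.ofReal_one]
  exact tsub_le_iff_right.2 h1
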